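/- Let $\mathcal X,\mathcal Z$ be finite sets, let $W\colon\mathcal X\to\mathcal Z$ be a discrete memoryless channel (stochastic matrix) with $n$-fold extension $W^n(z^n|x^n)=\prod_i W(z_i|x_i)$, let $P_X$ be a distribution on $\mathcal X$, and let $R\ge 0$. Given a distribution $P_{X^n}$ on $\mathcal X^n$, let $\mathcal C_n=(X^n_1,\dots,X^n_M)$ be a random code of $M=\lfloor e^{nR}\rfloor$ codewords drawn independently from $P_{X^n}$, and put $$P_{\mathcal C_n}(z^n)=\frac1M\sum_{i=1}^M W^n(z^n|X_i^n),\qquad \bar P_{Z^n}(z^n)=\sum_{x^n}P_{X^n}(x^n)W^n(z^n|x^n).$$ Notation: $D(P\|Q)=\sum_a P(a)\ln\frac{P(a)}{Q(a)}$ (equal to $+\infty$ unless $P\ll Q$); $H$ is the Shannon entropy; $(P\times V)(x,z)=P(x)V(z|x)$; $(P\circ V)(z)=\sum_xP(x)V(z|x)$; $D(V\|W|P)=D(P\times V\|P\times W)$; $I(P,W)$ is the mutual information of $P\times W$; $[a]^+=\max\{a,0\}$; $\mathcal P_n(\mathcal A)$ is the set of $n$-types on $\mathcal A$ (distributions $P$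 with $nP(a)\in\mathbb Z$ for all $a$), and $T^n_P\subseteq\mathcal A^n$ is the set of sequences with empirical distribution $P$. A sequence $p(n)>0$ is subexponential if $\frac1n\ln p(n)\to0$; $f(n)\doteq g(n)$ means that for some subexponential $p$ one has $f(n)\le p(n)g(n)$ and $g(n)\le p(n)f(n)$ for all sufficiently large $n$. (i) (i.i.d. sampling) Let $P_{X^n}=P_X^n$. If $I(P_X,W)>0$, then $$\mathbb E[D(P_{\mathcal C_n}\|\bar P_{Z^n})]\doteq\exp\bigl(-nE^{\rm iid}_{s,n}(P_X,W,R)\bigr),$$ where $$E^{\rm iid}_{s,n}(P_X,W,R)=\min_{Q\in\mathcal P_n(\mathcal X\times\mathcal Z)}\bigl\{D(Q\|P_X\times W)+[R-f(Q\|P_X\times W)]^+\bigr\},\qquad f(Q\|Q')=\sum_{x,z}Q(x,z)\ln\frac{Q'(x,z)}{Q'_X(x)Q'_Z(z)}$$ ($Q'_X,Q'_Z$ being the marginals of $Q'$). If $I(P_X,W)=0$, then $\mathbb E[D(P_{\mathcal C_n}\|\bar P_{Z^n})]=0$ for every $n$. (ii) (constant-composition sampling) Let $P_{X^n}$ be the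 uniform distribution on $T^n_{P_n}$, where $P_n\in\mathcal P_n(\mathcal X)$. If $I(P_X,W)>0$ and $\sum_x|P_n(x)-P_X(x)|\to0$, then $$\mathbb E[D(P_{\mathcal C_n}\|\bar P_{Z^n})]\doteq\exp\bigl(-nE^{\rm cc}_{s,n}(P_n,W,R)\bigr),$$ where the subexponential factor $p$ can be chosen depending only on $(P_X,W,R)$ and not on the sequence $(P_n)$ (while "sufficiently large $n$" may depend on the sequence), and $$E^{\rm cc}_{s,n}(P,W,R)=\min_{V:\,P\times V\in\mathcal P_n(\mathcal X\times\mathcal Z)}\bigl\{D(V\|W|P)+[R-g_n(V\|W|P)]^+\bigr\},$$ $$g_n(V\|W|P)=\sum_{x,z}P(x)V(z|x)\ln W(z|x)+H(P\circ V)+\min_{\substack{V':\,P\times V'\in\mathcal P_n(\mathcal X\times\mathcal Z),\\ P\circ V'=P\circ V}}D(V'\|W|P)$$ ($V,V'$ ranging over stochastic matrices $\mathcal X\to\mathcal Z$). If $I(P_X,W)=0$, then $\mathbb E[D(P_{\mathcal C_n}\|\bar P_{Z^n})]=0$ for every $n\ge1$ such that $\operatorname{supp}(P_n)\subseteq\operatorname{supp}(P_X)$.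 -/

import Mathlib

open Filter Topology

noncomputable section

namespace Resolvability

variable {A X Z : Type*} [Fintype A] [Fintype X] [Fintype Z]

/-! Distributions on a finite alphabet `A` are the members of `stdSimplex ℝ A`; a channel from `X` to
`Z` is a function `W : X → Z → ℝ` (written `W(z|x) = W x z`) whose rows `W x` are distributions.
Logarithms and exponentials are natural. -/

/-- `W` is a channel (a stochastic matrix). -/
def IsChannel (W : X → Z → ℝ) : Prop := ∀ x, W x ∈ stdSimplex ℝ Z

/-- The joint distribution `P × V`. -/
def joint (P : X → ℝ) (V : X → Z → ℝ) : X × Z → ℝ := fun q => P q.1 * V q.1 q.2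

/-- The output distribution `P ∘ V`. -/
def output (P : X → ℝ) (V : X → Z → ℝ) : Z → ℝ := fun z => ∑ x, P x * V x z

/-- The first marginal `Q_X`. -/
def margX (Q : X × Z → ℝ) : X → ℝ := fun x => ∑ z, Q (x, z)

/-- The second marginal `Q_Z`. -/
def margZ (Q : X × Z → ℝ) : Z → ℝ := fun z => ∑ x, Q (x, z)

/-- The product distribution `P^n` on sequences of length `n`. -/
def power (n : ℕ) (P : X → ℝ) : (Fin n → X) → ℝ := fun x => ∏ i, P (x i)

/-- The memoryless extension `W^n` of a channel. -/
def powerChannel (n : ℕ) (W : X → Z → ℝ) : (Fin n → X) → (Fin n → Z) → ℝ :=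
  fun x z => ∏ i, W (x i) (z i)

/-- The logarithm of a nonnegative real number, with `log 0 = -∞`. -/
def elog (t : ℝ) : EReal := ENNReal.log (ENNReal.ofReal t)

open Classical in
/-- The divergence `D(P‖Q) = ∑ P log (P / Q)`, equal to `+∞` when `P` is not absolutely continuous
with respect to `Q`. In the finite case the terms with `P a = 0` are `0`. -/
def div (P Q : A → ℝ) : EReal :=
  if ∀ a, Q a = 0 → P a = 0 then ((∑ a, P a * Real.log (P a / Q a) : ℝ) : EReal) else ⊤

/-- The conditional divergence `D(V‖W|P)`. -/
def condDiv (V W : X → Z → ℝ) (P : X → ℝ) : EReal := div (joint P V) (joint P W)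

/-- The Shannon entropy. -/
def entropy (P : A → ℝ) : ℝ := -∑ a, P a * Real.log (P a)

/-- The mutual information `I(P, W) = D(Q‖Q_X × Q_Z)` for `Q = P × W`. -/
def mutualInfo (P : X → ℝ) (W : X → Z → ℝ) : EReal :=
  div (joint P W) (fun q => margX (joint P W) q.1 * margZ (joint P W) q.2)

/-- The set `𝒫_n(A)` of `n`-types: distributions `P` with `n P(a)` an integer for all `a`. -/
def types (n : ℕ) (A : Type*) [Fintype A] : Set (A → ℝ) :=
  {P | P ∈ stdSimplex ℝ A ∧ ∀ a, ∃ k : ℤ, (n : ℝ) * P a = k}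

/-- The type (empirical distribution) of a sequence. -/
def empirical {n : ℕ} (x : Fin n → A) : A → ℝ := fun a => (Nat.card {i // x i = a} : ℝ) / n

/-- The type class: all sequences of length `n` whose type is `P`. -/
def typeClass (n : ℕ) (P : A → ℝ) : Set (Fin n → A) := {x | empirical x = P}

/-- The uniform distribution on the type class of `P`. -/
def uniformOnType (n : ℕ) (P : A → ℝ) : (Fin n → A) → ℝ :=
  (typeClass n P).indicator (fun _ => 1 / ((typeClass n P).ncard : ℝ))

/-- The output distribution of `W^n` when a uniformly chosen codeword of the code `c` is sent. -/
def codeOutput {M n : ℕ} (W : X → Z → ℝ) (c : Fin M → Fin n → X) : (Fin n → Z) → ℝ :=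
  fun z => 1 / (M : ℝ) * ∑ i, powerChannel n W (c i) z

/-- The number `M = ⌊exp(nR)⌋` of codewords. -/
def codeSize (n : ℕ) (R : ℝ) : ℕ := ⌊Real.exp (n * R)⌋₊

/-- The expectation of `D(P_C‖P ∘ W^n)` for the random code `C` of `⌊exp(nR)⌋` codewords of length
`n` drawn independently from the distribution `P` on `X^n`. -/
def expectedDiv (n : ℕ) (P : (Fin n → X) → ℝ) (W : X → Z → ℝ) (R : ℝ) : EReal :=
  ∑ c : Fin (codeSize n R) → Fin n → X,
    ((∏ i, P (c i) : ℝ) : EReal) * div (codeOutput W c) (output P (powerChannel n W))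

/-- `f(Q‖Q') = ∑ Q(x,z) log (Q'(x,z) / (Q'_X(x) Q'_Z(z)))`. -/
def fInfo (Q Q' : X × Z → ℝ) : EReal :=
  ∑ q, (Q q : EReal) * elog (Q' q / (margX Q' q.1 * margZ Q' q.2))

/-- `ω(V‖W|P) = ∑ P(x) V(z|x) log W(z|x)`. -/
def omega (V W : X → Z → ℝ) (P : X → ℝ) : EReal :=
  ∑ q : X × Z, ((P q.1 * V q.1 q.2 : ℝ) : EReal) * elog (W q.1 q.2)

/-- The exponent of the i.i.d. ensemble. The infimum is a minimum, over a finite set of `Q`. -/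
def expIID (n : ℕ) (P : X → ℝ) (W : X → Z → ℝ) (R : ℝ) : EReal :=
  ⨅ Q ∈ types n (X × Z), (div Q (joint P W) + max ((R : EReal) - fInfo Q (joint P W)) 0)

/-- The channels `V` such that `P × V` is an `n`-type. -/
def typeChannels (n : ℕ) (P : X → ℝ) : Set (X → Z → ℝ) :=
  {V | IsChannel V ∧ joint P V ∈ types n (X × Z)}

/-- `g_n(V‖W|P) = ω(V‖W|P) + H(P ∘ V) + min D(V'‖W|P)`, with the minimum over all `V'` such that
`P × V'` is an `n`-type and `P ∘ V' = P ∘ V`. -/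
def gInfo (n : ℕ) (V W : X → Z → ℝ) (P : X → ℝ) : EReal :=
  omega V W P + (entropy (output P V) : EReal) +
    ⨅ V' ∈ {V' ∈ typeChannels n P | output P V' = output P V}, condDiv V' W P

/-- The exponent of the constant-composition ensemble. The infima here and in `gInfo` are minima:
the terms depend on the channels only through the `n`-types `P × V` and `P × V'`. -/
def expCC (n : ℕ) (P : X → ℝ) (W : X → Z → ℝ) (R : ℝ) : EReal :=
  ⨅ V ∈ (typeChannels n P : Set (X → Z → ℝ)),
    (condDiv V W P + max ((R : EReal) - gInfo n V W P) 0)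

/-- `exp(-n E)` for an extended real `E`. -/
def expNeg (n : ℕ) (E : EReal) : EReal := (EReal.exp (-(((n : ℝ) : EReal) * E)) : ENNReal)

/-- A positive sequence with `(1/n) log p(n) → 0`. -/
def Subexponential (p : ℕ → ℝ) : Prop :=
  (∀ n, 0 < p n) ∧ Tendsto (fun n : ℕ => 1 / (n : ℝ) * Real.log (p n)) atTop (𝓝 0)

/-- `f` and `g` agree up to the factor `p(n)` for all large `n`; the relation `f ≐ g` says that this
holds for some subexponential `p`. -/
def DotEqBy (p : ℕ → ℝ) (f g : ℕ → EReal) : Prop :=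
  ∀ᶠ n in atTop, f n ≤ (p n : EReal) * g n ∧ g n ≤ (p n : EReal) * f n

end Resolvability

end

/-!
For a code `c` of `M` independent codewords and an output sequence `z`, write `L(z)` for the ratio
of the output probability of the code to its mean `P̄(z)`. It is the average of the `M` independent
likelihood ratios `ℓ(c i, z) = W^n(z|c i) / P̄(z)`, which have mean `1`, and the expected divergence
is `∑ z, P̄(z) E[L(z) log L(z)]`. The proof compares this expectation with the *truncated mean*
`S = E[min {1, ℓ / M}]`, taken under the joint distribution of a codeword and its output, and then
computes `S` by the method of types.

* Upper bound (`sum_prod_mul_log_le`, `meanDiv_le`). One factor `ℓ(c i, z)` of `L(z)` is singled out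
  and the logarithm is replaced by its tangent at `1 + ℓ(c i, z) / M`, which exceeds the conditional
  mean of `L(z)` given `c i` by `1 / M` only. This gives `E[log (1 + ℓ / M)]` under the joint
  distribution, and `log (1 + ℓ / M)` is at most `min {1, ℓ / M}` times a linear function of `n`.
* Lower bound (`le_sum_prod_mul_log`, `truncatedMean_le`). By the Donsker–Varadhan inequality
  `t log t ≥ s t + t - e ^ s` with `s = ∑ i, (g(c i) - E g)` and `g` a truncated multiple of
  `(ℓ - 1)⁺ / M`, the expectation is bounded below by the part of `S` where `ℓ ≥ 2`, up to a
  constant. That part carries a fixed fraction of `S` once `ℓ ≥ 2` has probability at least one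
  half.
* Positive mutual information enters only here: some row of the channel then differs from the output
  distribution, their Hellinger affinity is less than `1`, and Chernoff's bound with exponent one
  half shows that `ℓ < 2` is exponentially unlikely (`eventually_half_le_power`,
  `eventually_half_le_uniformOnType`).
* The truncated mean is a sum over joint types `Q`. Type classes have size `exp (n H(Q))` up to a
  polynomial factor, and there are polynomially many types, so that `S` is the largest of the terms
  `exp (-n (D + [R - f]⁺))` up to such a factor (`expIID_bounds`, `expCC_bounds`). For the
  constant-composition ensemble `P̄` is permutation invariant, hence the probability of an output
  sequence is that of its type divided by the size of the type class, and the probability of the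
  type is again a sum over joint types (`output_prob_bounds`); this is the inner minimum in `g_n`.

For the constant-composition ensemble all polynomial factors depend only on the alphabets, so the
same one serves every sequence of types.
If the mutual information vanishes, all inputs in the support of `P_X` have the same output
distribution, and every code of positive probability reproduces it exactly (`meanDiv_eq_zero`).
-/

open Filter Topology

noncomputable section

namespace Resolvability

/-! ### Expectations over independent samples -/

section Sampling

variable {Ω : Type*} [Fintype Ω]

/-- Fubini for a product of finite sums. -/
lemma sum_pi_prod {ι : Type*} [Fintype ι] [DecidableEq ι] (F : ι → Ω → ℝ) :
    ∑ c : ι → Ω, ∏ i, F i (c i) = ∏ i, ∑ x, F i x := by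
  rw [Finset.prod_univ_sum, Fintype.piFinset_univ]

variable {P : Ω → ℝ} {M : ℕ}

/-- One coordinate of an independent sample has the sampling distribution. -/
lemma sum_prod_mul_apply (hP : ∑ x, P x = 1) (g : Ω → ℝ) (i : Fin M) :
    ∑ c : Fin M → Ω, (∏ k, P (c k)) * g (c i) = ∑ x, P x * g x := by
  classical
  have h := sum_pi_prod (fun k x => P x * if k = i then g x else 1 : Fin M → Ω → ℝ)
  simp only [Finset.prod_mul_distrib, Finset.prod_ite_eq', Finset.mem_univ, if_true] at h
  rw [h, Finset.prod_eq_single i]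
  · simp
  · intro k _ hk
    simp [hk, hP]
  · simp

/-- Two distinct coordinates of an independent sample are independent. -/
lemma sum_prod_mul_apply_apply (hP : ∑ x, P x = 1) (g k : Ω → ℝ) {i j : Fin M} (hij : i ≠ j) :
    ∑ c : Fin M → Ω, (∏ l, P (c l)) * (g (c i) * k (c j)) =
      (∑ x, P x * g x) * ∑ x, P x * k x := by
  classical
  have h := sum_pi_prod
    (fun l x => P x * ((if l = i then g x else 1) * if l = j then k x else 1) : Fin M → Ω → ℝ)
  simp only [Finset.prod_mul_distrib, Finset.prod_ite_eq', Finset.mem_univ, if_true] at h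
  rw [h, Finset.prod_eq_mul i j hij]
  · simp [hij, hij.symm]
  · intro l _ hl
    simp [hl.1, hl.2, hP]
  · simp
  · simp

variable {l : Ω → ℝ}

/-- The random codeword that produces the output is separated from the others, which are replaced by
their mean: the logarithm is bounded by its tangent at `1 + ℓ(c i) / M`. -/
lemma sum_prod_mul_log_le (hP0 : ∀ x, 0 ≤ P x) (hP : ∑ x, P x = 1) (hl0 : ∀ x, 0 ≤ l x)
    (hl : ∑ x, P x * l x = 1) (hM : 1 ≤ M) :
    ∑ c : Fin M → Ω, (∏ k, P (c k)) *
        ((1 / (M : ℝ) * ∑ i, l (c i)) * Real.log (1 / (M : ℝ) * ∑ i, l (c i))) ≤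
      ∑ x, P x * (l x * Real.log (1 + l x / M)) := by
  have hM0 : (0 : ℝ) < M := by exact_mod_cast hM
  have ha : ∀ x, 0 < 1 + l x / M := fun x => by have := hl0 x; positivity
  have key : ∀ i : Fin M, ∑ c : Fin M → Ω, (∏ k, P (c k)) *
      (l (c i) * Real.log (1 / (M : ℝ) * ∑ j, l (c j))) ≤
        ∑ x, P x * (l x * Real.log (1 + l x / M)) := by
    intro i
    -- the tangent bound, valid also where the average vanishes since then `l (c i) = 0`
    have tangent : ∀ c : Fin M → Ω, l (c i) * Real.log (1 / (M : ℝ) * ∑ j, l (c j)) ≤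
        l (c i) * Real.log (1 + l (c i) / M) +
          (l (c i) / (1 + l (c i) / M)) * (1 / (M : ℝ) * ∑ j, l (c j)) - l (c i) := by
      intro c
      rcases (hl0 (c i)).eq_or_lt with h0 | h0
      · simp [← h0]
      have hs : l (c i) ≤ ∑ j, l (c j) :=
        Finset.single_le_sum (f := fun j => l (c j)) (fun j _ => hl0 _) (Finset.mem_univ i)
      have hL : 0 < 1 / (M : ℝ) * ∑ j, l (c j) := by
        have : 0 < ∑ j, l (c j) := h0.trans_le hs
        positivity
      have h1 := Real.log_le_sub_one_of_pos (div_pos hL (ha (c i)))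
      rw [Real.log_div hL.ne' (ha _).ne'] at h1
      have h2 := mul_le_mul_of_nonneg_left h1 h0.le
      have h3 : l (c i) * ((1 / (M : ℝ) * ∑ j, l (c j)) / (1 + l (c i) / M) - 1) =
        (l (c i) / (1 + l (c i) / M)) * (1 / (M : ℝ) * ∑ j, l (c j)) - l (c i) := by ring
      linarith
    have hpi : ∀ c : Fin M → Ω, 0 ≤ ∏ k, P (c k) := fun c => Finset.prod_nonneg fun k _ => hP0 _
    have h1 := Finset.sum_le_sum fun c (_ : c ∈ (Finset.univ : Finset (Fin M → Ω))) =>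
      mul_le_mul_of_nonneg_left (tangent c) (hpi c)
    refine h1.trans ?_
    set q : Ω → ℝ := fun x => l x / (1 + l x / M) with hq
    have hpair : ∀ j, ∑ c : Fin M → Ω, (∏ k, P (c k)) * (q (c i) * l (c j)) =
        if j = i then ∑ x, P x * (q x * l x) else ∑ x, P x * q x := by
      intro j
      split_ifs with hj
      · subst hj
        exact sum_prod_mul_apply hP (fun x => q x * l x) j
      · rw [sum_prod_mul_apply_apply hP q l (Ne.symm hj), hl, mul_one]
    have hsum : ∑ c : Fin M → Ω, (∏ k, P (c k)) * (q (c i) * (1 / (M : ℝ) * ∑ j, l (c j))) =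
        1 / (M : ℝ) * (∑ x, P x * (q x * l x) + ((M : ℝ) - 1) * ∑ x, P x * q x) := by
      have : ∀ c : Fin M → Ω, (∏ k, P (c k)) * (q (c i) * (1 / (M : ℝ) * ∑ j, l (c j))) =
          ∑ j, 1 / (M : ℝ) * ((∏ k, P (c k)) * (q (c i) * l (c j))) := by
        intro c
        rw [← Finset.mul_sum, ← Finset.mul_sum, ← Finset.mul_sum]
        ring
      simp_rw [this]
      rw [Finset.sum_comm]
      simp_rw [← Finset.mul_sum, hpair]
      congr 1
      rw [Finset.sum_ite, Finset.sum_const, Finset.sum_const]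
      have e1 : (Finset.univ.filter fun j : Fin M => j = i).card = 1 := by
        rw [Finset.filter_eq' , if_pos (Finset.mem_univ _), Finset.card_singleton]
      have e2 : (Finset.univ.filter fun j : Fin M => ¬ j = i).card = M - 1 := by
        have := Finset.card_filter_add_card_filter_not (s := (Finset.univ : Finset (Fin M)))
          (fun j => j = i)
        simp only [Finset.card_univ, Fintype.card_fin] at this
        omega
      rw [e1, e2, one_smul, nsmul_eq_mul, Nat.cast_sub hM, Nat.cast_one]
    have hexp : ∑ c : Fin M → Ω, (∏ k, P (c k)) * (l (c i) * Real.log (1 + l (c i) / M) +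
          q (c i) * (1 / (M : ℝ) * ∑ j, l (c j)) - l (c i)) =
        ∑ x, P x * (l x * Real.log (1 + l x / M)) +
          1 / (M : ℝ) * (∑ x, P x * (q x * l x) + ((M : ℝ) - 1) * ∑ x, P x * q x) - 1 := by
      simp_rw [mul_sub, mul_add, Finset.sum_sub_distrib, Finset.sum_add_distrib]
      rw [← mul_add, ← hsum, sum_prod_mul_apply hP (fun x => l x * Real.log (1 + l x / M)) i,
        sum_prod_mul_apply hP l i, hl]
    rw [hexp]
    have hql : 1 / (M : ℝ) * ∑ x, P x * (q x * l x) + ∑ x, P x * q x = 1 := by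
      rw [Finset.mul_sum, ← Finset.sum_add_distrib]
      refine (Finset.sum_congr rfl fun x _ => ?_).trans hl
      have : q x * (1 + l x / M) = l x := div_mul_cancel₀ _ (ha x).ne'
      calc 1 / (M : ℝ) * (P x * (q x * l x)) + P x * q x = P x * (q x * (1 + l x / M)) := by ring
        _ = _ := by rw [this]
    have hq0 : 0 ≤ 1 / (M : ℝ) * ∑ x, P x * q x :=
      mul_nonneg (by positivity) (Finset.sum_nonneg fun x _ =>
        mul_nonneg (hP0 x) (div_nonneg (hl0 x) (ha x).le))
    have h4 : 1 / (M : ℝ) * (∑ x, P x * (q x * l x) + ((M : ℝ) - 1) * ∑ x, P x * q x) =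
      1 / (M : ℝ) * ∑ x, P x * (q x * l x) + ∑ x, P x * q x - 1 / (M : ℝ) * ∑ x, P x * q x := by
      field_simp
      ring
    rw [h4, hql]
    linarith
  have hsplit : ∀ c : Fin M → Ω, (∏ k, P (c k)) *
        ((1 / (M : ℝ) * ∑ i, l (c i)) * Real.log (1 / (M : ℝ) * ∑ i, l (c i))) =
      ∑ i, 1 / (M : ℝ) * ((∏ k, P (c k)) *
        (l (c i) * Real.log (1 / (M : ℝ) * ∑ j, l (c j)))) := by
    intro c
    rw [← Finset.mul_sum, ← Finset.mul_sum, ← Finset.sum_mul]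
    ring
  simp_rw [hsplit]
  rw [Finset.sum_comm]
  simp_rw [← Finset.mul_sum]
  calc 1 / (M : ℝ) * ∑ i : Fin M, ∑ c : Fin M → Ω, (∏ k, P (c k)) *
        (l (c i) * Real.log (1 / (M : ℝ) * ∑ j, l (c j)))
      ≤ 1 / (M : ℝ) * ∑ _i : Fin M, ∑ x, P x * (l x * Real.log (1 + l x / M)) :=
        mul_le_mul_of_nonneg_left (Finset.sum_le_sum fun i _ => key i) (by positivity)
    _ = _ := by
        rw [Finset.sum_const, Finset.card_univ, Fintype.card_fin, nsmul_eq_mul]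
        field_simp

/-- The Legendre duality between `t log t` and the exponential function. -/
lemma mul_add_sub_exp_le_mul_log {t : ℝ} (ht : 0 ≤ t) (s : ℝ) :
    s * t + t - Real.exp s ≤ t * Real.log t := by
  rcases ht.eq_or_lt with rfl | h
  · simp [Real.exp_nonneg]
  · have h1 : Real.exp s = t * Real.exp (s - Real.log t) := by
      rw [Real.exp_sub, Real.exp_log h]
      field_simp
    have h2 := mul_le_mul_of_nonneg_left (Real.add_one_le_exp (s - Real.log t)) h.le
    rw [h1]
    linarith

/-- The Donsker–Varadhan bound with the test function `∑ i, (g (c i) - E g)`. -/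
lemma le_sum_prod_mul_log (hP0 : ∀ x, 0 ≤ P x) (hP : ∑ x, P x = 1) (hl0 : ∀ x, 0 ≤ l x)
    (hl : ∑ x, P x * l x = 1) (hM : 1 ≤ M) {g : Ω → ℝ} (hg0 : ∀ x, 0 ≤ g x) (hg1 : ∀ x, g x ≤ 1)
    (hgM : M * ∑ x, P x * g x ^ 2 ≤ 1) :
    ∑ x, P x * (g x * (l x - 1)) - 2 * (M * ∑ x, P x * g x ^ 2) ≤
      ∑ c : Fin M → Ω, (∏ k, P (c k)) *
        ((1 / (M : ℝ) * ∑ i, l (c i)) * Real.log (1 / (M : ℝ) * ∑ i, l (c i))) := by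
  have hM0 : (0 : ℝ) < M := by exact_mod_cast hM
  set μ : ℝ := ∑ x, P x * g x with hμ
  set v : ℝ := ∑ x, P x * g x ^ 2 with hv
  have hv0 : 0 ≤ v := Finset.sum_nonneg fun x _ => mul_nonneg (hP0 x) (sq_nonneg _)
  have hpi : ∀ c : Fin M → Ω, 0 ≤ ∏ k, P (c k) := fun c => Finset.prod_nonneg fun k _ => hP0 _
  have h1 := Finset.sum_le_sum fun c (_ : c ∈ (Finset.univ : Finset (Fin M → Ω))) =>
    mul_le_mul_of_nonneg_left
      (mul_add_sub_exp_le_mul_log (t := 1 / (M : ℝ) * ∑ i, l (c i))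
        (mul_nonneg (by positivity) (Finset.sum_nonneg fun i _ => hl0 _))
        (∑ i, (g (c i) - μ))) (hpi c)
  refine le_trans ?_ h1
  have hmean : ∑ c : Fin M → Ω, (∏ k, P (c k)) * (1 / (M : ℝ) * ∑ i, l (c i)) = 1 := by
    have : ∀ c : Fin M → Ω, (∏ k, P (c k)) * (1 / (M : ℝ) * ∑ i, l (c i)) =
        ∑ i, 1 / (M : ℝ) * ((∏ k, P (c k)) * l (c i)) := by
      intro c
      rw [← Finset.mul_sum, ← Finset.mul_sum]
      ring
    simp_rw [this]
    rw [Finset.sum_comm]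
    simp_rw [← Finset.mul_sum, sum_prod_mul_apply hP l, hl]
    simp
    field_simp
  have hcross : ∑ c : Fin M → Ω, (∏ k, P (c k)) *
      ((∑ i, (g (c i) - μ)) * (1 / (M : ℝ) * ∑ i, l (c i))) = ∑ x, P x * (g x * l x) - μ := by
    have h0 : ∑ x, P x * (g x - μ) = 0 := by
      simp_rw [mul_sub, Finset.sum_sub_distrib, ← Finset.sum_mul, hP, hμ]
      ring
    have : ∀ c : Fin M → Ω, (∏ k, P (c k)) *
        ((∑ i, (g (c i) - μ)) * (1 / (M : ℝ) * ∑ i, l (c i))) =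
        ∑ i, ∑ j, 1 / (M : ℝ) * ((∏ k, P (c k)) * ((g (c i) - μ) * l (c j))) := by
      intro c
      simp_rw [← Finset.mul_sum, ← Finset.sum_mul]
      ring
    simp_rw [this]
    rw [Finset.sum_comm]
    have hi : ∀ i : Fin M, ∑ c : Fin M → Ω,
        ∑ j, 1 / (M : ℝ) * ((∏ k, P (c k)) * ((g (c i) - μ) * l (c j))) =
        1 / (M : ℝ) * (∑ x, P x * (g x * l x) - μ) := by
      intro i
      rw [Finset.sum_comm, Finset.sum_eq_single i]
      · rw [← Finset.mul_sum, sum_prod_mul_apply hP (fun x => (g x - μ) * l x) i]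
        congr 1
        have : ∑ x, P x * (μ * l x) = μ := by
          calc ∑ x, P x * (μ * l x) = μ * ∑ x, P x * l x := by
                rw [Finset.mul_sum]
                exact Finset.sum_congr rfl fun x _ => by ring
            _ = μ := by rw [hl, mul_one]
        simp_rw [sub_mul, mul_sub, Finset.sum_sub_distrib, this]
      · intro j _ hj
        rw [← Finset.mul_sum, sum_prod_mul_apply_apply hP (fun x => g x - μ) l (Ne.symm hj), h0]
        ring
      · simp
    simp_rw [hi]
    simp only [Finset.sum_const, Finset.card_univ, Fintype.card_fin, nsmul_eq_mul]
    field_simp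
  have hmgf : ∑ c : Fin M → Ω, (∏ k, P (c k)) * Real.exp (∑ i, (g (c i) - μ)) ≤
      1 + 2 * (M * v) := by
    have : ∑ c : Fin M → Ω, (∏ k, P (c k)) * Real.exp (∑ i, (g (c i) - μ)) =
        (∑ x, P x * Real.exp (g x - μ)) ^ M := by
      simp_rw [Real.exp_sum, ← Finset.prod_mul_distrib]
      rw [sum_pi_prod (fun _ x => P x * Real.exp (g x - μ))]
      simp
    rw [this]
    have hone : ∑ x, P x * Real.exp (g x - μ) ≤ Real.exp v := by
      have hb : ∑ x, P x * Real.exp (g x) ≤ 1 + μ + v := by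
        rw [hμ, hv, ← hP, ← Finset.sum_add_distrib, ← Finset.sum_add_distrib]
        refine Finset.sum_le_sum fun x _ => ?_
        have := Real.abs_exp_sub_one_sub_id_le (x := g x) (by
          rw [abs_of_nonneg (hg0 x)]
          exact hg1 x)
        have h2 := mul_le_mul_of_nonneg_left ((abs_le.1 this).2) (hP0 x)
        linarith
      have : ∑ x, P x * Real.exp (g x - μ) = (∑ x, P x * Real.exp (g x)) * Real.exp (-μ) := by
        rw [Finset.sum_mul]
        refine Finset.sum_congr rfl fun x _ => ?_
        rw [sub_eq_add_neg, Real.exp_add]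
        ring
      rw [this]
      calc (∑ x, P x * Real.exp (g x)) * Real.exp (-μ)
          ≤ Real.exp (μ + v) * Real.exp (-μ) := by
            refine mul_le_mul_of_nonneg_right (hb.trans ?_) (Real.exp_nonneg _)
            have := Real.add_one_le_exp (μ + v)
            linarith
        _ = Real.exp v := by
            rw [← Real.exp_add]
            congr 1
            ring
    calc (∑ x, P x * Real.exp (g x - μ)) ^ M ≤ Real.exp v ^ M :=
          pow_le_pow_left₀ (Finset.sum_nonneg fun x _ => mul_nonneg (hP0 x) (Real.exp_nonneg _))
            hone M
      _ = Real.exp (M * v) := by rw [← Real.exp_nat_mul]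
      _ ≤ 1 + 2 * (M * v) := by
          have h0 : 0 ≤ M * v := by positivity
          have := Real.abs_exp_sub_one_sub_id_le (x := M * v) (by rwa [abs_of_nonneg h0])
          have := (abs_le.1 this).2
          nlinarith
  have hlin : ∑ x, P x * (g x * (l x - 1)) = ∑ x, P x * (g x * l x) - μ := by
    rw [hμ, ← Finset.sum_sub_distrib]
    exact Finset.sum_congr rfl fun x _ => by ring
  rw [hlin, Finset.sum_congr rfl fun c (_ : c ∈ (Finset.univ : Finset (Fin M → Ω))) =>
    show (∏ k, P (c k)) * ((∑ i, (g (c i) - μ)) * (1 / (M : ℝ) * ∑ i, l (c i)) +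
        1 / (M : ℝ) * ∑ i, l (c i) - Real.exp (∑ i, (g (c i) - μ))) =
      (∏ k, P (c k)) * ((∑ i, (g (c i) - μ)) * (1 / (M : ℝ) * ∑ i, l (c i))) +
        (∏ k, P (c k)) * (1 / (M : ℝ) * ∑ i, l (c i)) -
        (∏ k, P (c k)) * Real.exp (∑ i, (g (c i) - μ)) by ring,
    Finset.sum_sub_distrib, Finset.sum_add_distrib, hmean, hcross]
  linarith

/-- The lower bound that matches `sum_prod_mul_log_le` up to a constant factor wherever `ℓ` is
bounded away from `1`. -/
lemma le_sum_prod_mul_log_of_posPart (hP0 : ∀ x, 0 ≤ P x) (hP : ∑ x, P x = 1)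
    (hl0 : ∀ x, 0 ≤ l x) (hl : ∑ x, P x * l x = 1) (hM : 1 ≤ M) :
    1 / 2 * ∑ x, P x * (min 1 (max (l x - 1) 0 / (4 * M)) * max (l x - 1) 0) ≤
      ∑ c : Fin M → Ω, (∏ k, P (c k)) *
        ((1 / (M : ℝ) * ∑ i, l (c i)) * Real.log (1 / (M : ℝ) * ∑ i, l (c i))) := by
  have hM0 : (0 : ℝ) < M := by exact_mod_cast hM
  set u : Ω → ℝ := fun x => max (l x - 1) 0 with hu
  set g : Ω → ℝ := fun x => min 1 (u x / (4 * M)) with hg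
  have hu0 : ∀ x, 0 ≤ u x := fun x => le_max_right _ _
  have hg0 : ∀ x, 0 ≤ g x := fun x => le_min zero_le_one (div_nonneg (hu0 x) (by positivity))
  have hg1 : ∀ x, g x ≤ 1 := fun x => min_le_left _ _
  have hgu : ∀ x, g x * (l x - 1) = g x * u x := by
    intro x
    rcases le_total (l x - 1) 0 with h | h
    · have : u x = 0 := max_eq_right h
      simp [hg, this]
    · rw [hu]
      simp only
      rw [max_eq_left h]
  -- `M E g² ≤ E[g u] / 4 ≤ 1 / 4` by the choice of `g`
  have hsq : M * ∑ x, P x * g x ^ 2 ≤ 1 / 4 * ∑ x, P x * (g x * u x) := by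
    rw [Finset.mul_sum, Finset.mul_sum]
    refine Finset.sum_le_sum fun x _ => ?_
    have h1 : g x ≤ u x / (4 * M) := min_le_right _ _
    have h2 : M * g x ≤ 1 / 4 * u x := by
      rw [le_div_iff₀ (by positivity)] at h1
      linarith
    have := mul_le_mul_of_nonneg_left h2 (mul_nonneg (hP0 x) (hg0 x))
    linarith
  have hle1 : ∑ x, P x * (g x * u x) ≤ 1 := by
    rw [← hl]
    refine Finset.sum_le_sum fun x _ => mul_le_mul_of_nonneg_left ?_ (hP0 x)
    have h1 : u x ≤ l x := max_le (by linarith) (hl0 x)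
    calc g x * u x ≤ 1 * u x := mul_le_mul_of_nonneg_right (hg1 x) (hu0 x)
      _ ≤ l x := by linarith
  refine le_trans ?_ (le_sum_prod_mul_log hP0 hP hl0 hl hM hg0 hg1 (by linarith))
  simp_rw [hgu]
  linarith

end Sampling

/-! ### One-shot bounds on the expected divergence -/

section OneShot

variable {Ω Y : Type*} [Fintype Ω]

variable {P : Ω → ℝ} {U : Ω → Y → ℝ} {M : ℕ}

lemma mul_eq_zero_of_output_eq_zero (hP0 : ∀ x, 0 ≤ P x) (hU0 : ∀ x y, 0 ≤ U x y) {y : Y}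
    (h : output P U y = 0) (x : Ω) : P x * U x y = 0 :=
  (Finset.sum_eq_zero_iff_of_nonneg fun x _ => mul_nonneg (hP0 x) (hU0 x y)).1 h x
    (Finset.mem_univ x)

lemma mul_le_output (hP0 : ∀ x, 0 ≤ P x) (hU0 : ∀ x y, 0 ≤ U x y) (x : Ω) (y : Y) :
    P x * U x y ≤ output P U y :=
  Finset.single_le_sum (f := fun x => P x * U x y) (fun x _ => mul_nonneg (hP0 x) (hU0 x y))
    (Finset.mem_univ x)

lemma output_nonneg (hP0 : ∀ x, 0 ≤ P x) (hU0 : ∀ x y, 0 ≤ U x y) (y : Y) : 0 ≤ output P U y :=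
  Finset.sum_nonneg fun x _ => mul_nonneg (hP0 x) (hU0 x y)

/-- For a fixed output symbol the summand of `meanDiv` is an expectation of `L log L`, where `L` is
an average of likelihood ratios. -/
lemma sum_prod_mul_log_eq {y : Y} (hq : output P U y ≠ 0) :
    ∑ c : Fin M → Ω, (∏ k, P (c k)) * ((1 / (M : ℝ) * ∑ i, U (c i) y) *
        Real.log ((1 / (M : ℝ) * ∑ i, U (c i) y) / output P U y)) =
      output P U y * ∑ c : Fin M → Ω, (∏ k, P (c k)) *
        ((1 / (M : ℝ) * ∑ i, U (c i) y / output P U y) *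
          Real.log (1 / (M : ℝ) * ∑ i, U (c i) y / output P U y)) := by
  rw [Finset.mul_sum]
  refine Finset.sum_congr rfl fun c _ => ?_
  rw [← Finset.sum_div, ← mul_div_assoc]
  field_simp

lemma sum_prod_mul_log_eq_zero {y : Y} (hq : output P U y = 0) :
    ∑ c : Fin M → Ω, (∏ k, P (c k)) * ((1 / (M : ℝ) * ∑ i, U (c i) y) *
        Real.log ((1 / (M : ℝ) * ∑ i, U (c i) y) / output P U y)) = 0 := by
  simp [hq]

lemma sum_mul_div_output {y : Y} (hq : output P U y ≠ 0) :
    ∑ x, P x * (U x y / output P U y) = 1 := by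
  simp_rw [← mul_div_assoc]
  rw [← Finset.sum_div]
  exact div_self hq

variable [Fintype Y]

/-- The expectation, over independent codewords `c 0, …, c (M - 1)` from `P`, of the divergence of
the code's output distribution from `P ∘ U`, as a real number. -/
def meanDiv (P : Ω → ℝ) (U : Ω → Y → ℝ) (M : ℕ) : ℝ :=
  ∑ c : Fin M → Ω, (∏ k, P (c k)) * ∑ y, (1 / (M : ℝ) * ∑ i, U (c i) y) *
    Real.log ((1 / (M : ℝ) * ∑ i, U (c i) y) / output P U y)

/-- The expectation, under `P × U`, of `min {1, ℓ / M}` with `ℓ(x, y) = U(y|x) / (P ∘ U)(y)`. It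
agrees with `meanDiv` up to factors that do not affect the exponent. -/
def truncatedMean (P : Ω → ℝ) (U : Ω → Y → ℝ) (M : ℕ) : ℝ :=
  ∑ x, ∑ y, P x * U x y * min 1 (U x y / (M * output P U y))

lemma sum_mul_channel (hP : ∑ x, P x = 1) (hU : ∀ x, ∑ y, U x y = 1) :
    ∑ x, ∑ y, P x * U x y = 1 := by
  simp_rw [← Finset.mul_sum, hU, mul_one, hP]

lemma sum_output (hP : ∑ x, P x = 1) (hU : ∀ x, ∑ y, U x y = 1) :
    ∑ y, output P U y = 1 := by
  rw [← sum_mul_channel hP hU, Finset.sum_comm]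
  rfl

lemma meanDiv_eq : meanDiv P U M = ∑ y, ∑ c : Fin M → Ω, (∏ k, P (c k)) *
    ((1 / (M : ℝ) * ∑ i, U (c i) y) *
      Real.log ((1 / (M : ℝ) * ∑ i, U (c i) y) / output P U y)) := by
  simp_rw [meanDiv, Finset.mul_sum]
  rw [Finset.sum_comm]

lemma log_one_add_le_mul_min {t b : ℝ} (ht : 0 ≤ t) (hb : 0 ≤ b) (htb : t ≤ Real.exp b) :
    Real.log (1 + t) ≤ (1 + b) * min 1 t := by
  rcases le_total t 1 with h | h
  · rw [min_eq_right h]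
    have := Real.log_le_sub_one_of_pos (show 0 < 1 + t by linarith)
    nlinarith
  · rw [min_eq_left h, mul_one, Real.log_le_iff_le_exp (by linarith), Real.exp_add]
    have h2 : 2 ≤ Real.exp 1 := by
      have := Real.add_one_le_exp (1 : ℝ)
      linarith
    have h3 := Real.exp_pos b
    nlinarith

/-- Where `P x` is positive the likelihood ratio is at most `1 / P x`, so that `log (1 + ℓ / M)` is
at most `1 + b` times `min {1, ℓ / M}`. -/
lemma meanDiv_le (hP0 : ∀ x, 0 ≤ P x) (hP : ∑ x, P x = 1) (hU0 : ∀ x y, 0 ≤ U x y)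
    (hM : 1 ≤ M) {b : ℝ} (hb : 0 ≤ b) (hPb : ∀ x, P x ≠ 0 → Real.exp (-b) ≤ P x) :
    meanDiv P U M ≤ (1 + b) * truncatedMean P U M := by
  have hM1 : (1 : ℝ) ≤ M := by exact_mod_cast hM
  have hM0 : (0 : ℝ) < M := by linarith
  rw [meanDiv_eq, show truncatedMean P U M = _ from Finset.sum_comm, Finset.mul_sum]
  refine Finset.sum_le_sum fun y _ => ?_
  have hq0 := output_nonneg hP0 hU0 y
  rcases hq0.eq_or_lt with hq | hq
  · rw [sum_prod_mul_log_eq_zero hq.symm, Finset.sum_eq_zero, mul_zero]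
    intro x _
    rw [mul_eq_zero_of_output_eq_zero hP0 hU0 hq.symm, zero_mul]
  · rw [sum_prod_mul_log_eq hq.ne']
    refine (mul_le_mul_of_nonneg_left (sum_prod_mul_log_le hP0 hP
      (fun x => div_nonneg (hU0 x y) hq.le) (sum_mul_div_output hq.ne') hM) hq.le).trans ?_
    rw [Finset.mul_sum, Finset.mul_sum]
    refine Finset.sum_le_sum fun x _ => ?_
    rcases eq_or_ne (P x) 0 with hx | hx
    · simp [hx]
    have hxb := hPb x hx
    have hl : U x y / output P U y / M ≤ Real.exp b := by
      rw [div_div, div_le_iff₀ (by positivity)]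
      have h1 := mul_le_output hP0 hU0 x y
      have h2 : Real.exp (-b) * U x y ≤ output P U y :=
        (mul_le_mul_of_nonneg_right hxb (hU0 x y)).trans h1
      calc U x y = Real.exp b * (Real.exp (-b) * U x y) := by
            rw [← mul_assoc, ← Real.exp_add]
            simp
        _ ≤ Real.exp b * (output P U y * M) := by
            refine mul_le_mul_of_nonneg_left ?_ (Real.exp_nonneg _)
            nlinarith
    have h3 := log_one_add_le_mul_min
      (div_nonneg (div_nonneg (hU0 x y) hq.le) hM0.le) hb hl
    have h4 : U x y / output P U y / M = U x y / (M * output P U y) := by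
      rw [div_div, mul_comm]
    have h5 : output P U y * (P x * (U x y / output P U y *
        Real.log (1 + U x y / output P U y / M))) =
        P x * U x y * Real.log (1 + U x y / output P U y / M) := by
      field_simp
    rw [h5]
    calc P x * U x y * Real.log (1 + U x y / output P U y / M)
        ≤ P x * U x y * ((1 + b) * min 1 (U x y / output P U y / M)) :=
          mul_le_mul_of_nonneg_left h3 (mul_nonneg (hP0 x) (hU0 x y))
      _ = _ := by rw [h4]; ring

open Classical in
/-- The part of the truncated mean where the likelihood ratio is at least `2` bounds the expected
divergence from below. -/
lemma sum_ite_le_meanDiv (hP0 : ∀ x, 0 ≤ P x) (hP : ∑ x, P x = 1) (hU0 : ∀ x y, 0 ≤ U x y)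
    (hM : 1 ≤ M) :
    ∑ x, ∑ y, (if 2 * output P U y ≤ U x y then
      P x * U x y * min 1 (U x y / (M * output P U y)) else 0) ≤ 32 * meanDiv P U M := by
  have hM0 : (0 : ℝ) < M := by exact_mod_cast hM
  rw [meanDiv_eq, Finset.sum_comm, Finset.mul_sum]
  refine Finset.sum_le_sum fun y _ => ?_
  have hq0 := output_nonneg hP0 hU0 y
  rcases hq0.eq_or_lt with hq | hq
  · rw [sum_prod_mul_log_eq_zero hq.symm, Finset.sum_eq_zero, mul_zero]
    intro x _
    rw [mul_eq_zero_of_output_eq_zero hP0 hU0 hq.symm, zero_mul, ite_self]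
  rw [sum_prod_mul_log_eq hq.ne']
  have h1 := mul_le_mul_of_nonneg_left (le_sum_prod_mul_log_of_posPart hP0 hP
      (fun x => div_nonneg (hU0 x y) hq.le) (sum_mul_div_output hq.ne') hM) hq.le
  refine le_trans ?_ (mul_le_mul_of_nonneg_left h1 (by norm_num : (0 : ℝ) ≤ 32))
  rw [Finset.mul_sum, Finset.mul_sum, Finset.mul_sum]
  refine Finset.sum_le_sum fun x _ => ?_
  set l : ℝ := U x y / output P U y with hl
  have hUl : U x y = output P U y * l := by rw [hl]; field_simp
  split_ifs with h
  · have hl2 : 2 ≤ l := by rwa [hl, le_div_iff₀ hq]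
    have hu : max (l - 1) 0 = l - 1 := max_eq_left (by linarith)
    have h4 : U x y / (M * output P U y) = l / M := by
      rw [hl, div_div, mul_comm]
    have h5 : 1 / 8 * min 1 (l / M) ≤ min 1 ((l - 1) / (4 * M)) := by
      refine le_min ?_ ?_
      · have := min_le_left 1 (l / M)
        linarith
      · calc 1 / 8 * min 1 (l / M) ≤ 1 / 8 * (l / M) := by
              have := min_le_right 1 (l / M)
              linarith
          _ = (l / 2) / (4 * M) := by field_simp; norm_num
          _ ≤ (l - 1) / (4 * M) := by
              refine div_le_div_of_nonneg_right ?_ (by positivity)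
              linarith
    have hmin : 0 ≤ min 1 (l / M) := le_min zero_le_one (by positivity)
    rw [hu, h4, hUl]
    have h6 : 1 / 16 * (min 1 (l / M) * l) ≤ min 1 ((l - 1) / (4 * M)) * (l - 1) := by
      calc 1 / 16 * (min 1 (l / M) * l) = (1 / 8 * min 1 (l / M)) * (l / 2) := by ring
        _ ≤ min 1 ((l - 1) / (4 * M)) * (l - 1) :=
          mul_le_mul h5 (by linarith) (by linarith) (le_trans (by positivity) h5)
    have h7 := mul_le_mul_of_nonneg_left h6 (mul_nonneg (hP0 x) hq.le)
    linarith
  · have : 0 ≤ min 1 (max (l - 1) 0 / (4 * M)) * max (l - 1) 0 :=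
      mul_nonneg (le_min zero_le_one (div_nonneg (le_max_right _ _) (by positivity)))
        (le_max_right _ _)
    have hPx := hP0 x
    positivity

open Classical in
/-- Likelihood ratios below `2` contribute at most `min {1, 2 / M}`, and those above, which have
probability at least one half, contribute at least half of it. -/
lemma truncatedMean_le (hP0 : ∀ x, 0 ≤ P x) (hP : ∑ x, P x = 1) (hU0 : ∀ x y, 0 ≤ U x y)
    (hU : ∀ x, ∑ y, U x y = 1) (hM : 1 ≤ M)
    (h2 : 1 / 2 ≤ ∑ x, ∑ y, if 2 * output P U y ≤ U x y then P x * U x y else 0) :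
    truncatedMean P U M ≤ 96 * meanDiv P U M := by
  have hM0 : (0 : ℝ) < M := by exact_mod_cast hM
  have hlow := sum_ite_le_meanDiv hP0 hP hU0 hM
  set S2 := ∑ x, ∑ y, (if 2 * output P U y ≤ U x y then
      P x * U x y * min 1 (U x y / (M * output P U y)) else 0) with hS2
  set m : ℝ := min 1 (2 / M)
  have hm0 : 0 ≤ m := le_min zero_le_one (by positivity)
  have hS2m : m * (1 / 2) ≤ S2 := by
    refine (mul_le_mul_of_nonneg_left h2 hm0).trans ?_
    rw [Finset.mul_sum]
    refine Finset.sum_le_sum fun x _ => ?_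
    rw [Finset.mul_sum]
    refine Finset.sum_le_sum fun y _ => ?_
    split_ifs with h
    · rcases (output_nonneg hP0 hU0 y).eq_or_lt with hq | hq
      · rw [mul_eq_zero_of_output_eq_zero hP0 hU0 hq.symm]
        simp
      · rw [mul_comm]
        refine mul_le_mul_of_nonneg_left ?_ (mul_nonneg (hP0 x) (hU0 x y))
        refine min_le_min le_rfl ?_
        rw [div_le_div_iff₀ hM0 (by positivity)]
        nlinarith
    · simp
  have hS : truncatedMean P U M ≤ S2 + m := by
    have hmm : m = ∑ x, ∑ y, P x * U x y * m := by
      simp_rw [← Finset.sum_mul]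
      rw [sum_mul_channel hP hU, one_mul]
    rw [hmm, hS2, ← Finset.sum_add_distrib, truncatedMean]
    refine Finset.sum_le_sum fun x _ => ?_
    rw [← Finset.sum_add_distrib]
    refine Finset.sum_le_sum fun y _ => ?_
    have hPU := mul_nonneg (hP0 x) (hU0 x y)
    split_ifs with h
    · have := mul_nonneg hPU hm0
      linarith
    · rw [zero_add]
      refine mul_le_mul_of_nonneg_left (min_le_min le_rfl ?_) hPU
      rcases (output_nonneg hP0 hU0 y).eq_or_lt with hq | hq
      · rw [← hq, mul_zero, div_zero]
        positivity
      · rw [div_le_div_iff₀ (by positivity) hM0]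
        nlinarith
  linarith

end OneShot

section Channel

variable {X Z : Type*} [Fintype Z] {W : X → Z → ℝ}

lemma powerChannel_nonneg (hW : IsChannel W) (n : ℕ) (x : Fin n → X) (z : Fin n → Z) :
    0 ≤ powerChannel n W x z :=
  Finset.prod_nonneg fun i _ => (hW (x i)).1 (z i)

lemma sum_powerChannel (hW : IsChannel W) (n : ℕ) (x : Fin n → X) :
    ∑ z, powerChannel n W x z = 1 := by
  unfold powerChannel
  rw [sum_pi_prod (fun i => W (x i))]
  exact Finset.prod_eq_one fun i _ => (hW (x i)).2

lemma power_mem_stdSimplex {A : Type*} [Fintype A] {P : A → ℝ} (hP : P ∈ stdSimplex ℝ A) (n : ℕ) :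
    power n P ∈ stdSimplex ℝ (Fin n → A) := by
  refine ⟨fun x => Finset.prod_nonneg fun i _ => hP.1 _, ?_⟩
  unfold power
  rw [sum_pi_prod (fun _ => P)]
  simp [hP.2]

lemma one_le_codeSize {R : ℝ} (hR : 0 ≤ R) (n : ℕ) : 1 ≤ codeSize n R :=
  Nat.le_floor (by simpa using Real.one_le_exp (by positivity : 0 ≤ (n : ℝ) * R))

lemma codeSize_le (n : ℕ) (R : ℝ) : (codeSize n R : ℝ) ≤ Real.exp (n * R) :=
  Nat.floor_le (Real.exp_nonneg _)

lemma exp_le_two_mul_codeSize {R : ℝ} (hR : 0 ≤ R) (n : ℕ) :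
    Real.exp (n * R) ≤ 2 * codeSize n R := by
  have h1 := Nat.lt_floor_add_one (Real.exp (n * R))
  have h2 : (1 : ℝ) ≤ codeSize n R := by exact_mod_cast one_le_codeSize hR n
  have h3 : Real.exp (n * R) < codeSize n R + 1 := h1
  linarith

variable [Fintype X]

lemma ereal_coe_sum {ι : Type*} (s : Finset ι) (f : ι → ℝ) :
    ((∑ i ∈ s, f i : ℝ) : EReal) = ∑ i ∈ s, (f i : EReal) :=
  map_sum (⟨⟨Real.toEReal, EReal.coe_zero⟩, EReal.coe_add⟩ : ℝ →+ EReal) f s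

/-- A code of positive probability has an output distribution that is absolutely continuous with
respect to `P ∘ W^n`, so the expected divergence is the real number `meanDiv`. -/
lemma expectedDiv_eq (hW : IsChannel W) {n : ℕ} {P : (Fin n → X) → ℝ}
    (hP0 : ∀ x, 0 ≤ P x) (R : ℝ) :
    expectedDiv n P W R = (meanDiv P (powerChannel n W) (codeSize n R) : ℝ) := by
  classical
  rw [expectedDiv, meanDiv, ereal_coe_sum]
  refine Finset.sum_congr rfl fun c _ => ?_
  by_cases hc : ∏ k, P (c k) = 0
  · rw [hc]
    simp
  · have hac : ∀ z, output P (powerChannel n W) z = 0 → codeOutput W c z = 0 := by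
      intro z hz
      rw [codeOutput, Finset.sum_eq_zero, mul_zero]
      intro i _
      have h := mul_eq_zero_of_output_eq_zero hP0 (powerChannel_nonneg hW n) hz (c i)
      exact (mul_eq_zero.1 h).resolve_left fun h0 =>
        hc (Finset.prod_eq_zero (Finset.mem_univ i) h0)
    rw [div, if_pos hac, EReal.coe_mul]
    rfl

end Channel

/-! ### The method of types -/

section Types

variable {A : Type*}

lemma card_fiber_eq_of_empirical_eq {n : ℕ} (hn : 1 ≤ n) {x y : Fin n → A}
    (h : empirical x = empirical y) (a : A) :
    Nat.card {i // x i = a} = Nat.card {i // y i = a} := by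
  have h1 := congrFun h a
  have hn0 : (n : ℝ) ≠ 0 := by positivity
  simp only [empirical] at h1
  rw [div_left_inj' hn0] at h1
  exact_mod_cast h1

/-- Sequences of the same type are permutations of each other. -/
lemma exists_perm_of_empirical_eq {n : ℕ} (hn : 1 ≤ n) {x y : Fin n → A}
    (h : empirical x = empirical y) : ∃ σ : Equiv.Perm (Fin n), x ∘ σ = y := by
  have e : ∀ a, Nonempty ({i // y i = a} ≃ {i // x i = a}) := fun a =>
    Finite.card_eq.1 (card_fiber_eq_of_empirical_eq hn h a).symm
  refine ⟨Equiv.ofFiberEquiv fun a => (e a).some, ?_⟩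
  ext i
  exact Equiv.ofFiberEquiv_map _ i

lemma empirical_comp_perm {n : ℕ} (x : Fin n → A) (σ : Equiv.Perm (Fin n)) :
    empirical (x ∘ σ) = empirical x := by
  ext a
  simp only [empirical, Function.comp_apply]
  congr 2
  exact Nat.card_congr (σ.subtypeEquiv fun i => Iff.rfl)

lemma empirical_apply_ne_zero {n : ℕ} (hn : 1 ≤ n) (x : Fin n → A) (i : Fin n) :
    empirical x (x i) ≠ 0 := by
  have hn0 : (n : ℝ) ≠ 0 := by positivity
  have : Nonempty {j // x j = x i} := ⟨⟨i, rfl⟩⟩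
  have h : Nat.card {j // x j = x i} ≠ 0 := Nat.card_pos.ne'
  exact div_ne_zero (by exact_mod_cast h) hn0

lemma exists_apply_eq_of_empirical_ne_zero {n : ℕ} {x : Fin n → A} {a : A}
    (h : empirical x a ≠ 0) : ∃ i, x i = a := by
  by_contra! hx
  have : IsEmpty {i // x i = a} := ⟨fun i => hx i.1 i.2⟩
  exact h (by simp [empirical])

variable [Fintype A]

lemma sum_card_fiber {n : ℕ} (x : Fin n → A) : ∑ a, Nat.card {i // x i = a} = n := by
  rw [← Nat.card_sigma, Nat.card_congr (Equiv.sigmaFiberEquiv x), Nat.card_fin]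

lemma empirical_mem_types {n : ℕ} (hn : 1 ≤ n) (x : Fin n → A) : empirical x ∈ types n A := by
  have hn0 : (n : ℝ) ≠ 0 := by positivity
  refine ⟨⟨fun a => by simp only [empirical]; positivity, ?_⟩, fun a => ?_⟩
  · simp only [empirical]
    rw [← Finset.sum_div, ← Nat.cast_sum, sum_card_fiber, div_self hn0]
  · exact ⟨Nat.card {i // x i = a}, by simp only [empirical]; field_simp; norm_cast⟩

lemma exists_empirical_eq {n : ℕ} (hn : 1 ≤ n) {P : A → ℝ} (hP : P ∈ types n A) :
    ∃ x : Fin n → A, empirical x = P := by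
  have hn0 : (n : ℝ) ≠ 0 := by positivity
  have hk : ∀ a, ∃ k : ℕ, (n : ℝ) * P a = k := by
    intro a
    obtain ⟨k, hk⟩ := hP.2 a
    have : (0 : ℝ) ≤ k := hk ▸ mul_nonneg (by positivity) (hP.1.1 a)
    lift k to ℕ using by exact_mod_cast this
    exact ⟨k, by exact_mod_cast hk⟩
  choose k hk using hk
  have hsum : ∑ a, k a = n := by
    have : (∑ a, (k a : ℝ)) = n := by
      simp_rw [← hk, ← Finset.mul_sum, hP.1.2, mul_one]
    exact_mod_cast this
  have e : Fin n ≃ Σ a, Fin (k a) := (Fintype.equivFinOfCardEq (by simp [hsum])).symm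
  refine ⟨fun i => (e i).1, ?_⟩
  ext a
  have : Nat.card {i // (e i).1 = a} = k a := by
    rw [Nat.card_congr ((e.subtypeEquiv (q := fun s => s.1 = a) fun i => Iff.rfl).trans
      (Equiv.sigmaSubtype a)), Nat.card_fin]
  simp only [empirical]
  rw [this, ← hk]
  field_simp

open Classical in
lemma ncard_typeClass (n : ℕ) (P : A → ℝ) :
    (typeClass n P).ncard = (Finset.univ.filter fun x : Fin n → A => empirical x = P).card := by
  rw [Set.ncard_eq_toFinset_card']
  congr 1
  ext x
  rw [Set.mem_toFinset]
  simp [typeClass]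

/-- The size of a type class is a multinomial coefficient, by counting permutations. -/
lemma ncard_typeClass_mul_prod_factorial {n : ℕ} (hn : 1 ≤ n) (x : Fin n → A) :
    (typeClass n (empirical x)).ncard * ∏ a, (Nat.card {i // x i = a}).factorial =
      n.factorial := by
  classical
  have hstab : (Finset.univ.filter fun σ : Equiv.Perm (Fin n) => x ∘ σ = x).card =
      ∏ a, (Nat.card {i // x i = a}).factorial := by
    have := DomMulAct.stabilizer_card x
    rw [Fintype.card_subtype] at this
    rw [this]
    simp [Nat.card_eq_fintype_card]
  have hfib : ∀ y ∈ Finset.univ.filter fun y : Fin n → A => empirical y = empirical x,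
      (Finset.univ.filter fun σ : Equiv.Perm (Fin n) => x ∘ σ = y).card =
        ∏ a, (Nat.card {i // x i = a}).factorial := by
    intro y hy
    obtain ⟨τ, rfl⟩ := exists_perm_of_empirical_eq hn (Finset.mem_filter.1 hy).2.symm
    rw [← hstab]
    refine Finset.card_equiv (Equiv.mulRight τ⁻¹) fun σ => ?_
    simp only [Finset.mem_filter, Finset.mem_univ, true_and, Equiv.coe_mulRight, Equiv.Perm.coe_mul]
    constructor
    · intro h
      rw [← Function.comp_assoc, h, Function.comp_assoc, ← Equiv.Perm.coe_mul, mul_inv_cancel]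
      rfl
    · intro h
      nth_rewrite 2 [← h]
      rw [Function.comp_assoc, Function.comp_assoc, ← Equiv.Perm.coe_mul, inv_mul_cancel]
      rfl
  have h := Finset.card_eq_sum_card_fiberwise (f := fun σ : Equiv.Perm (Fin n) => x ∘ σ)
    (s := Finset.univ) (t := Finset.univ.filter fun y : Fin n → A => empirical y = empirical x)
    (fun σ _ => by simp [empirical_comp_perm])
  rw [Finset.sum_congr rfl hfib, Finset.sum_const, smul_eq_mul, ← ncard_typeClass,
    Finset.card_univ, Fintype.card_perm, Fintype.card_fin] at h
  exact h.symm

lemma prod_apply_eq_prod_pow {n : ℕ} (x : Fin n → A) (F : A → ℝ) :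
    ∏ i, F (x i) = ∏ a, F a ^ Nat.card {i // x i = a} := by
  classical
  rw [← Finset.prod_fiberwise' Finset.univ x F]
  refine Finset.prod_congr rfl fun a _ => ?_
  rw [Finset.prod_const, Nat.card_eq_fintype_card, Fintype.card_subtype]

/-- A memoryless weight of a sequence depends on its type only. -/
lemma prod_apply_eq_exp {n : ℕ} (hn : 1 ≤ n) (x : Fin n → A) {F : A → ℝ}
    (hF : ∀ a, empirical x a ≠ 0 → 0 < F a) :
    ∏ i, F (x i) = Real.exp (n * ∑ a, empirical x a * Real.log (F a)) := by
  have hn0 : (n : ℝ) ≠ 0 := by positivity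
  rw [prod_apply_eq_prod_pow, Finset.mul_sum, Real.exp_sum]
  refine Finset.prod_congr rfl fun a _ => ?_
  rcases eq_or_ne (Nat.card {i // x i = a}) 0 with h0 | h0
  · simp [empirical, h0]
  · have hpos : 0 < F a := hF a (div_ne_zero (by exact_mod_cast h0) hn0)
    have : (n : ℝ) * (empirical x a * Real.log (F a)) =
        (Nat.card {i // x i = a} : ℝ) * Real.log (F a) := by
      simp only [empirical]
      field_simp
    rw [this, Real.exp_nat_mul, Real.exp_log hpos]

lemma prod_empirical {n : ℕ} (hn : 1 ≤ n) (x : Fin n → A) :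
    ∏ i, empirical x (x i) = Real.exp (-(n * entropy (empirical x))) := by
  rw [prod_apply_eq_exp hn x fun a ha => lt_of_le_of_ne ((empirical_mem_types hn x).1.1 a) ha.symm,
    entropy]
  congr 1
  ring

/-- `k! ≤ e (k + 1) (k / e) ^ k`. -/
lemma factorial_mul_exp_le (k : ℕ) :
    (k.factorial : ℝ) * Real.exp k ≤ Real.exp 1 * (k + 1) * (k : ℝ) ^ k := by
  rcases Nat.eq_zero_or_pos k with rfl | hk
  · simp
  have key : ∀ k : ℕ, 1 ≤ k → (k.factorial : ℝ) * Real.exp k ≤ Real.exp 1 * (k : ℝ) ^ (k + 1) := by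
    intro k hk
    induction k, hk using Nat.le_induction with
    | base => simp
    | succ k hk ih =>
      have hk0 : (0 : ℝ) < k := by exact_mod_cast hk
      -- `e ≤ (1 + 1 / k) ^ (k + 1)`
      have he : Real.exp 1 * (k : ℝ) ^ (k + 1) ≤ ((k : ℝ) + 1) ^ (k + 1) := by
        have h1 : Real.exp (1 / ((k : ℝ) + 1)) ≤ (k + 1) / k := by
          rw [← Real.le_log_iff_exp_le (by positivity)]
          have := Real.one_sub_inv_le_log_of_pos (show (0 : ℝ) < (k + 1) / k by positivity)
          refine le_trans (le_of_eq ?_) this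
          field_simp
          ring
        have h2 := pow_le_pow_left₀ (Real.exp_nonneg _) h1 (k + 1)
        rw [← Real.exp_nat_mul, div_pow, le_div_iff₀ (by positivity)] at h2
        refine le_trans (le_of_eq ?_) h2
        congr 2
        push_cast
        field_simp
      rw [Nat.factorial_succ]
      push_cast
      rw [Real.exp_add]
      calc ((k : ℝ) + 1) * k.factorial * (Real.exp k * Real.exp 1)
          = ((k : ℝ) + 1) * Real.exp 1 * (k.factorial * Real.exp k) := by ring
        _ ≤ ((k : ℝ) + 1) * Real.exp 1 * (Real.exp 1 * (k : ℝ) ^ (k + 1)) :=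
            mul_le_mul_of_nonneg_left ih (by positivity)
        _ ≤ ((k : ℝ) + 1) * Real.exp 1 * ((k : ℝ) + 1) ^ (k + 1) :=
            mul_le_mul_of_nonneg_left he (by positivity)
        _ = Real.exp 1 * ((k : ℝ) + 1) ^ (k + 1 + 1) := by ring
  calc (k.factorial : ℝ) * Real.exp k ≤ Real.exp 1 * (k : ℝ) ^ (k + 1) := key k hk
    _ = Real.exp 1 * k * (k : ℝ) ^ k := by ring
    _ ≤ _ := by gcongr; linarith

variable (A) in
/-- The polynomial `(e (n + 1)) ^ |A|`, which bounds the number of types and the gap between the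
size of a type class and `exp (n H)`. -/
def typeLoss (n : ℕ) : ℝ := (Real.exp 1 * (n + 1)) ^ Fintype.card A

lemma typeLoss_pos (n : ℕ) : 0 < typeLoss A n := by
  unfold typeLoss
  positivity

lemma one_le_typeLoss (n : ℕ) : 1 ≤ typeLoss A n := by
  refine one_le_pow₀ ?_
  have : (1 : ℝ) ≤ Real.exp 1 := Real.one_le_exp zero_le_one
  have : (0 : ℝ) ≤ n := by positivity
  nlinarith

/-- The lower bound on the size of a type class, from `n! ≥ (n / e) ^ n` and the upper bound on the
factorials in the denominator of the multinomial coefficient. -/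
lemma exp_entropy_le {n : ℕ} (hn : 1 ≤ n) {P : A → ℝ} (hP : P ∈ types n A) :
    Real.exp (n * entropy P) ≤ typeLoss A n * (typeClass n P).ncard := by
  obtain ⟨x, rfl⟩ := exists_empirical_eq hn hP
  have hn0 : (0 : ℝ) < n := by exact_mod_cast hn
  set k : A → ℕ := fun a => Nat.card {i // x i = a} with hk
  have hkn : ∑ a, k a = n := sum_card_fiber x
  have hmul : ((typeClass n (empirical x)).ncard : ℝ) * ∏ a, ((k a).factorial : ℝ) =
      n.factorial := by
    exact_mod_cast ncard_typeClass_mul_prod_factorial hn x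
  have hent : Real.exp (-(n * entropy (empirical x))) = (∏ a, (k a : ℝ) ^ k a) / (n : ℝ) ^ n := by
    rw [← prod_empirical hn, prod_apply_eq_prod_pow]
    simp only [empirical, div_pow]
    rw [Finset.prod_div_distrib, Finset.prod_pow_eq_pow_sum, sum_card_fiber]
  have hfact : (∏ a, ((k a).factorial : ℝ)) * Real.exp n ≤
      typeLoss A n * ∏ a, (k a : ℝ) ^ k a := by
    have : Real.exp n = ∏ a, Real.exp (k a) := by
      rw [← Real.exp_sum, ← Nat.cast_sum, hkn]
    rw [this, ← Finset.prod_mul_distrib, typeLoss, ← Finset.card_univ, ← Finset.prod_const,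
      ← Finset.prod_mul_distrib]
    refine Finset.prod_le_prod (fun a _ => by positivity) fun a _ => ?_
    refine (factorial_mul_exp_le (k a)).trans ?_
    have : (k a : ℝ) ≤ n := by
      rw [← hkn]
      exact_mod_cast Finset.single_le_sum (f := k) (fun _ _ => Nat.zero_le _) (Finset.mem_univ a)
    gcongr
  have hlow : (n : ℝ) ^ n ≤ n.factorial * Real.exp n := by
    have := Real.pow_div_factorial_le_exp (n : ℝ) hn0.le n
    rw [div_le_iff₀ (by positivity)] at this
    linarith
  have h1 : (n : ℝ) ^ n ≤ typeLoss A n * (typeClass n (empirical x)).ncard *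
      ∏ a, (k a : ℝ) ^ k a := by
    calc (n : ℝ) ^ n ≤ n.factorial * Real.exp n := hlow
      _ = (typeClass n (empirical x)).ncard * ((∏ a, ((k a).factorial : ℝ)) * Real.exp n) := by
          rw [← hmul]
          ring
      _ ≤ (typeClass n (empirical x)).ncard * (typeLoss A n * ∏ a, (k a : ℝ) ^ k a) :=
          mul_le_mul_of_nonneg_left hfact (by positivity)
      _ = _ := by ring
  have h2 : 1 ≤ typeLoss A n * (typeClass n (empirical x)).ncard *
      Real.exp (-(n * entropy (empirical x))) := by
    rw [hent, ← mul_div_assoc, le_div_iff₀ (by positivity), one_mul]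
    exact h1
  rw [Real.exp_neg, ← div_eq_mul_inv, le_div_iff₀ (Real.exp_pos _), one_mul] at h2
  exact h2

/-- Each sequence of type `P` has probability `exp (-n H(P))` under `P ^ n`. -/
lemma ncard_typeClass_le {n : ℕ} (hn : 1 ≤ n) {P : A → ℝ} (hP : P ∈ types n A) :
    ((typeClass n P).ncard : ℝ) ≤ Real.exp (n * entropy P) := by
  classical
  have h1 : ((typeClass n P).ncard : ℝ) * Real.exp (-(n * entropy P)) ≤ 1 := by
    have hpow := power_mem_stdSimplex hP.1 n
    rw [ncard_typeClass, ← nsmul_eq_mul, ← Finset.sum_const, ← hpow.2]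
    calc ∑ x ∈ Finset.univ.filter (fun x : Fin n → A => empirical x = P),
          Real.exp (-(n * entropy P))
        = ∑ x ∈ Finset.univ.filter (fun x : Fin n → A => empirical x = P), power n P x := by
          refine Finset.sum_congr rfl fun x hx => ?_
          obtain rfl := (Finset.mem_filter.1 hx).2
          exact (prod_empirical hn x).symm
      _ ≤ ∑ x, power n P x :=
          Finset.sum_le_sum_of_subset_of_nonneg (Finset.filter_subset _ _) fun x _ _ => hpow.1 x
  rwa [Real.exp_neg, ← div_eq_mul_inv, div_le_iff₀ (Real.exp_pos _), one_mul] at h1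

lemma ncard_typeClass_pos {n : ℕ} (hn : 1 ≤ n) {P : A → ℝ} (hP : P ∈ types n A) :
    0 < ((typeClass n P).ncard : ℝ) := by
  have h := (Real.exp_pos _).trans_le (exp_entropy_le hn hP)
  exact pos_of_mul_pos_right h (typeLoss_pos n).le

open Classical in
variable (A) in
/-- The types of the sequences of length `n`, as a finset. -/
def typeFinset (n : ℕ) : Finset (A → ℝ) :=
  Finset.univ.image (empirical : (Fin n → A) → A → ℝ)

lemma mem_typeFinset {n : ℕ} (hn : 1 ≤ n) {P : A → ℝ} : P ∈ typeFinset A n ↔ P ∈ types n A := by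
  simp only [typeFinset, Finset.mem_image, Finset.mem_univ, true_and]
  exact ⟨fun ⟨x, hx⟩ => hx ▸ empirical_mem_types hn x, fun h => exists_empirical_eq hn h⟩

lemma card_typeFinset_le (n : ℕ) : ((typeFinset A n).card : ℝ) ≤ typeLoss A n := by
  classical
  have hle : ∀ (x : Fin n → A) (a : A), Nat.card {i // x i = a} < n + 1 := by
    intro x a
    have := Finset.single_le_sum (f := fun a => Nat.card {i // x i = a})
      (fun _ _ => Nat.zero_le _) (Finset.mem_univ a)
    rw [sum_card_fiber] at this
    exact Nat.lt_succ_of_le this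
  have hsub : typeFinset A n ⊆
      Finset.univ.image fun (k : A → Fin (n + 1)) (a : A) => ((k a : ℕ) : ℝ) / n := by
    intro P hP
    obtain ⟨x, -, rfl⟩ := Finset.mem_image.1 hP
    exact Finset.mem_image.2 ⟨fun a => ⟨_, hle x a⟩, Finset.mem_univ _, rfl⟩
  have h1 : (typeFinset A n).card ≤ (n + 1) ^ Fintype.card A := by
    refine (Finset.card_le_card hsub).trans (Finset.card_image_le.trans (le_of_eq ?_))
    simp
  calc ((typeFinset A n).card : ℝ) ≤ ((n : ℝ) + 1) ^ Fintype.card A := by exact_mod_cast h1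
    _ ≤ typeLoss A n := by
        unfold typeLoss
        refine pow_le_pow_left₀ (by positivity) ?_ _
        have := Real.one_le_exp (zero_le_one : (0 : ℝ) ≤ 1)
        have : (0 : ℝ) ≤ n := by positivity
        nlinarith

open Classical in
lemma sum_eq_sum_typeFinset {n : ℕ} (G : (Fin n → A) → ℝ) :
    ∑ x, G x = ∑ P ∈ typeFinset A n,
      ∑ x ∈ Finset.univ.filter (fun x : Fin n → A => empirical x = P), G x :=
  (Finset.sum_fiberwise_of_maps_to
    (fun x _ => Finset.mem_image.2 ⟨x, Finset.mem_univ _, rfl⟩) G).symm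

end Types

/-! ### Exponents in the extended reals -/

section Exponents

lemma expNeg_coe (n : ℕ) (r : ℝ) : expNeg n (r : EReal) = (Real.exp (-(n * r)) : ℝ) := by
  rw [expNeg, show -(((n : ℝ) : EReal) * (r : EReal)) = ((-(n * r) : ℝ) : EReal) by push_cast; rfl,
    EReal.exp_coe, EReal.coe_ennreal_ofReal, max_eq_left (Real.exp_nonneg _)]

lemma expNeg_top {n : ℕ} (hn : 1 ≤ n) : expNeg n ⊤ = 0 := by
  have : (0 : ℝ) < n := by exact_mod_cast hn
  rw [expNeg, EReal.coe_mul_top_of_pos this]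
  simp

lemma expNeg_bot {n : ℕ} (hn : 1 ≤ n) : expNeg n ⊥ = ⊤ := by
  have : (0 : ℝ) < n := by exact_mod_cast hn
  rw [expNeg, EReal.coe_mul_bot_of_pos this]
  simp

lemma expNeg_nonneg (n : ℕ) (E : EReal) : 0 ≤ expNeg n E := EReal.coe_ennreal_nonneg _

lemma expNeg_antitone (n : ℕ) {E E' : EReal} (h : E ≤ E') : expNeg n E' ≤ expNeg n E := by
  rw [expNeg, expNeg, EReal.coe_ennreal_le_coe_ennreal_iff, EReal.exp_le_exp_iff,
    EReal.neg_le_neg_iff]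
  exact mul_le_mul_of_nonneg_left h (by exact_mod_cast n.cast_nonneg)

/-- The exponential decay of an infimum of exponents is at most any common bound on the exponential
decays. -/
lemma expNeg_iInf_le {n : ℕ} (hn : 1 ≤ n) {ι : Type*} {s : Set ι} {E : ι → EReal} {b : ℝ}
    (hb : 0 ≤ b) (h : ∀ i ∈ s, expNeg n (E i) ≤ b) : expNeg n (⨅ i ∈ s, E i) ≤ b := by
  have hn0 : (0 : ℝ) < n := by exact_mod_cast hn
  have key : ∀ e : EReal, expNeg n e ≤ b ↔
      -ENNReal.log (ENNReal.ofReal b) / ((n : ℝ) : EReal) ≤ e := by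
    intro e
    rw [EReal.div_le_iff_le_mul (by exact_mod_cast hn0) (EReal.coe_ne_top _), EReal.neg_le,
      ← EReal.exp_le_exp_iff (b := ENNReal.log _), ENNReal.exp_log,
      ← EReal.coe_ennreal_le_coe_ennreal_iff, EReal.coe_ennreal_ofReal, max_eq_left hb]
    rfl
  rw [key]
  exact le_iInf₂ fun i hi => (key _).1 (h i hi)

/-- If a finite sum `S` dominates all the terms `exp (-n E i)` and each summand is dominated by one
of them, then `S` and `exp (-n inf E)` agree up to the constants and the number of summands. -/
lemma expNeg_iInf_bounds {n : ℕ} (hn : 1 ≤ n) {ι τ : Type*} {s : Set ι} {E : ι → EReal}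
    {T : Finset τ} {G : τ → ℝ} {a c K : ℝ} (ha0 : 0 ≤ a) (hc0 : 0 ≤ c) (hK : (T.card : ℝ) ≤ K)
    (hG : 0 ≤ ∑ t ∈ T, G t)
    (ha : ∀ i ∈ s, expNeg n (E i) ≤ (a * ∑ t ∈ T, G t : ℝ))
    (hc : ∀ t ∈ T, G t = 0 ∨ ∃ i ∈ s, (G t : EReal) ≤ (c : EReal) * expNeg n (E i)) :
    expNeg n (⨅ i ∈ s, E i) ≤ (a * ∑ t ∈ T, G t : ℝ) ∧
      ((∑ t ∈ T, G t : ℝ) : EReal) ≤ ((c * K : ℝ) : EReal) * expNeg n (⨅ i ∈ s, E i) := by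
  have h1 := expNeg_iInf_le hn (mul_nonneg ha0 hG) ha
  refine ⟨h1, ?_⟩
  have h0 := expNeg_nonneg n (⨅ i ∈ s, E i)
  have hc0' : (0 : EReal) ≤ c := by exact_mod_cast hc0
  have hG' : ∀ t ∈ T, (G t : EReal) ≤ (c : EReal) * expNeg n (⨅ i ∈ s, E i) := by
    intro t ht
    rcases hc t ht with h | ⟨i, hi, h⟩
    · rw [h]
      exact mul_nonneg hc0' h0
    · exact h.trans (mul_le_mul_of_nonneg_left (expNeg_antitone n (iInf₂_le i hi)) hc0')
  generalize expNeg n (⨅ i ∈ s, E i) = γ at h1 h0 hG' ⊢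
  lift γ to ℝ using ⟨ne_top_of_le_ne_top (EReal.coe_ne_top _) h1,
    ne_bot_of_le_ne_bot EReal.zero_ne_bot h0⟩
  norm_cast at h0 hG' ⊢
  calc ∑ t ∈ T, G t ≤ ∑ _t ∈ T, c * γ := Finset.sum_le_sum hG'
    _ = T.card * (c * γ) := by rw [Finset.sum_const, nsmul_eq_mul]
    _ ≤ K * (c * γ) := mul_le_mul_of_nonneg_right hK (mul_nonneg hc0 h0)
    _ = _ := by ring

lemma elog_of_pos {t : ℝ} (ht : 0 < t) : elog t = (Real.log t : ℝ) := by
  rw [elog, ENNReal.log_ofReal, if_neg ht.not_ge]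

/-- A sum with extended logarithms is real if no logarithm of `0` has a nonzero coefficient. -/
lemma sum_mul_elog {A : Type*} [Fintype A] {Q F : A → ℝ} (h : ∀ a, Q a ≠ 0 → 0 < F a) :
    ∑ a, (Q a : EReal) * elog (F a) = ((∑ a, Q a * Real.log (F a) : ℝ) : EReal) := by
  rw [ereal_coe_sum]
  refine Finset.sum_congr rfl fun a _ => ?_
  rcases eq_or_ne (Q a) 0 with ha | ha
  · simp [ha]
  · rw [elog_of_pos (h a ha), EReal.coe_mul]

variable {A : Type*} [Fintype A]

lemma div_of_ac {P Q : A → ℝ} (h : ∀ a, Q a = 0 → P a = 0) :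
    div P Q = ((∑ a, P a * Real.log (P a / Q a) : ℝ) : EReal) := if_pos h

lemma div_of_not_ac {P Q : A → ℝ} (h : ¬ ∀ a, Q a = 0 → P a = 0) : div P Q = ⊤ := if_neg h

/-- `exp (-n (d + [R - f]⁺))` as a product. -/
lemma expNeg_add_max (n : ℕ) (d f R : ℝ) :
    expNeg n ((d : EReal) + max ((R : EReal) - f) 0) =
      (Real.exp (-(n * d)) * min 1 (Real.exp (n * f) / Real.exp (n * R)) : ℝ) := by
  have : (d : EReal) + max ((R : EReal) - f) 0 = ((d + max (R - f) 0 : ℝ) : EReal) := by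
    rw [EReal.coe_add, EReal.coe_strictMono.monotone.map_max]
    rfl
  rw [this, expNeg_coe, ← Real.exp_sub, ← Real.exp_zero, ← Real.exp_monotone.map_min,
    ← Real.exp_add]
  congr 2
  rw [mul_add, neg_add, mul_max_of_nonneg _ _ n.cast_nonneg, ← min_neg_neg]
  congr 1
  rw [mul_zero, neg_zero, min_comm]
  congr 1
  ring

lemma sum_mul_log_eq_neg_add {P Q : A → ℝ} (h : ∀ a, Q a = 0 → P a = 0) :
    ∑ a, P a * Real.log (Q a) = -(∑ a, P a * Real.log (P a / Q a) + entropy P) := by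
  rw [entropy, ← sub_eq_add_neg, ← Finset.sum_sub_distrib, ← Finset.sum_neg_distrib]
  refine Finset.sum_congr rfl fun a _ => ?_
  rcases eq_or_ne (P a) 0 with ha | ha
  · simp [ha]
  · rw [Real.log_div ha fun hq => ha (h a hq)]
    ring

end Exponents

/-! ### The exponent of the i.i.d. ensemble -/

section IID

variable {X Z : Type*} {W : X → Z → ℝ} {P : X → ℝ}

section

variable [Fintype Z]

lemma margX_joint (hW : IsChannel W) : margX (joint P W) = P := by
  ext x
  simp only [margX, joint]
  rw [← Finset.mul_sum, (hW x).2, mul_one]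

lemma margX_ne_zero {Q : X × Z → ℝ} (hQ : ∀ q, 0 ≤ Q q) {q : X × Z} (h : Q q ≠ 0) :
    margX Q q.1 ≠ 0 := fun h0 =>
  h ((Finset.sum_eq_zero_iff_of_nonneg fun z _ => hQ (q.1, z)).1 h0 q.2 (Finset.mem_univ _))

end

section

variable [Fintype X]

lemma margZ_joint : margZ (joint P W) = output P W := rfl

lemma output_power (n : ℕ) (z : Fin n → Z) :
    output (power n P) (powerChannel n W) z = ∏ i, output P W (z i) := by
  simp only [output, power, powerChannel, ← Finset.prod_mul_distrib]
  exact sum_pi_prod fun i x => P x * W x (z i)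

lemma margZ_ne_zero {Q : X × Z → ℝ} (hQ : ∀ q, 0 ≤ Q q) {q : X × Z} (h : Q q ≠ 0) :
    margZ Q q.2 ≠ 0 := fun h0 =>
  h ((Finset.sum_eq_zero_iff_of_nonneg fun x _ => hQ (x, q.2)).1 h0 q.1 (Finset.mem_univ _))

end

variable [Fintype X] [Fintype Z]

lemma joint_mem_stdSimplex (hP : P ∈ stdSimplex ℝ X) (hW : IsChannel W) :
    joint P W ∈ stdSimplex ℝ (X × Z) := by
  refine ⟨fun q => mul_nonneg (hP.1 _) ((hW _).1 _), ?_⟩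
  rw [Fintype.sum_prod_type]
  exact sum_mul_channel hP.2 fun x => (hW x).2

/-- A double sum over input and output sequences as a sum over sequences of pairs. -/
lemma sum_sum_eq_sum_pairs (n : ℕ) (F : (Fin n → X) → (Fin n → Z) → ℝ) :
    ∑ x, ∑ z, F x z = ∑ y : Fin n → X × Z, F (Prod.fst ∘ y) (Prod.snd ∘ y) := by
  rw [← Fintype.sum_prod_type']
  exact (Fintype.sum_equiv (Equiv.arrowProdEquivProdArrow (Fin n) (fun _ => X) (fun _ => Z)) _ _
    fun y => rfl).symm

/-- The information density weight `Q(x, z) / (Q_X(x) Q_Z(z))`. -/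
def densityRatio (Q : X × Z → ℝ) (q : X × Z) : ℝ := Q q / (margX Q q.1 * margZ Q q.2)

lemma truncatedMean_power (hW : IsChannel W) (n M : ℕ) :
    truncatedMean (power n P) (powerChannel n W) M =
      ∑ y : Fin n → X × Z, (∏ i, joint P W (y i)) *
        min 1 ((∏ i, densityRatio (joint P W) (y i)) / M) := by
  rw [truncatedMean, sum_sum_eq_sum_pairs n fun x z => power n P x * powerChannel n W x z *
    min 1 (powerChannel n W x z / (M * output (power n P) (powerChannel n W) z))]
  refine Finset.sum_congr rfl fun y _ => ?_
  have h1 : power n P (Prod.fst ∘ y) * powerChannel n W (Prod.fst ∘ y) (Prod.snd ∘ y) =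
      ∏ i, joint P W (y i) := by
    simp only [power, powerChannel, joint, ← Finset.prod_mul_distrib]
    rfl
  rw [h1]
  by_cases h0 : ∏ i, joint P W (y i) = 0
  · rw [h0, zero_mul, zero_mul]
  · congr 2
    rw [output_power, mul_comm, ← div_div]
    congr 1
    simp only [powerChannel]
    rw [← Finset.prod_div_distrib]
    refine Finset.prod_congr rfl fun i _ => ?_
    have hi : joint P W (y i) ≠ 0 := Finset.prod_ne_zero_iff.1 h0 i (Finset.mem_univ i)
    have hx : P (y i).1 ≠ 0 := fun h => hi (by simp [joint, h])
    rw [densityRatio, margX_joint hW, margZ_joint, joint]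
    simp only [Function.comp_apply]
    rw [mul_div_mul_left _ _ hx]

lemma fInfo_of_ac {Q J : X × Z → ℝ} (hJ : ∀ q, 0 ≤ J q) (h : ∀ q, J q = 0 → Q q = 0) :
    fInfo Q J = ((∑ q, Q q * Real.log (densityRatio J q) : ℝ) : EReal) := by
  refine sum_mul_elog (F := densityRatio J) fun q hq => ?_
  have hJq : J q ≠ 0 := fun h0 => hq (h q h0)
  have h1 := margX_ne_zero hJ hJq
  have h2 := margZ_ne_zero hJ hJq
  have h3 : 0 ≤ margX J q.1 := Finset.sum_nonneg fun _ _ => hJ _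
  have h4 : 0 ≤ margZ J q.2 := Finset.sum_nonneg fun _ _ => hJ _
  exact div_pos (lt_of_le_of_ne (hJ q) hJq.symm)
    (mul_pos (lt_of_le_of_ne h3 h1.symm) (lt_of_le_of_ne h4 h2.symm))

/-- The truncated mean of the i.i.d. ensemble is `exp (-n E)` up to a polynomial factor, by summing
over the joint types. -/
lemma expIID_bounds (hP : P ∈ stdSimplex ℝ X) (hW : IsChannel W) {R : ℝ} (hR : 0 ≤ R) {n : ℕ}
    (hn : 1 ≤ n) :
    expNeg n (expIID n P W R) ≤ ((typeLoss (X × Z) n *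
        truncatedMean (power n P) (powerChannel n W) (codeSize n R) : ℝ) : EReal) ∧
      ((truncatedMean (power n P) (powerChannel n W) (codeSize n R) : ℝ) : EReal) ≤
        ((2 * typeLoss (X × Z) n : ℝ) : EReal) * expNeg n (expIID n P W R) := by
  classical
  set J := joint P W
  set M := codeSize n R
  have hM0 : (0 : ℝ) < M := by exact_mod_cast one_le_codeSize hR n
  have hJ0 : ∀ q, 0 ≤ J q := (joint_mem_stdSimplex hP hW).1
  set term : (Fin n → X × Z) → ℝ := fun y => (∏ i, J (y i)) *
        min 1 ((∏ i, densityRatio J (y i)) / M) with hterm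
  have hterm0 : ∀ y, 0 ≤ term y := fun y => by
    have : 0 ≤ ∏ i, densityRatio J (y i) := Finset.prod_nonneg fun i _ =>
      div_nonneg (hJ0 _) (mul_nonneg (Finset.sum_nonneg fun _ _ => hJ0 _)
        (Finset.sum_nonneg fun _ _ => hJ0 _))
    exact mul_nonneg (Finset.prod_nonneg fun i _ => hJ0 _) (le_min zero_le_one (by positivity))
  set G : (X × Z → ℝ) → ℝ := fun Q =>
    ∑ y ∈ Finset.univ.filter (fun y : Fin n → X × Z => empirical y = Q), term y with hG
  have hS : truncatedMean (power n P) (powerChannel n W) M = ∑ Q ∈ typeFinset (X × Z) n, G Q := by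
    rw [truncatedMean_power hW, sum_eq_sum_typeFinset]
  have hG0 : ∀ Q, 0 ≤ G Q := fun Q => Finset.sum_nonneg fun y _ => hterm0 y
  -- the value of `G` on a type that is absolutely continuous with respect to `J`
  have hval : ∀ Q ∈ types n (X × Z), (∀ q, J q = 0 → Q q = 0) →
      G Q = (typeClass n Q).ncard * (Real.exp (-(n * entropy Q)) *
        (Real.exp (-(n * ∑ q, Q q * Real.log (Q q / J q))) *
          min 1 (Real.exp (n * ∑ q, Q q * Real.log (densityRatio J q)) / M))) := by
    intro Q hQ hac
    rw [ncard_typeClass, ← nsmul_eq_mul, ← Finset.sum_const]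
    refine Finset.sum_congr rfl fun y hy => ?_
    obtain rfl := (Finset.mem_filter.1 hy).2
    have hpos : ∀ q, empirical y q ≠ 0 → 0 < J q := fun q hq =>
      lt_of_le_of_ne (hJ0 q) fun h => hq (hac q h.symm)
    have hpos' : ∀ q, empirical y q ≠ 0 → 0 < densityRatio J q := fun q hq =>
      div_pos (hpos q hq) (mul_pos
        (lt_of_le_of_ne (Finset.sum_nonneg fun _ _ => hJ0 _)
          (margX_ne_zero hJ0 (hpos q hq).ne').symm)
        (lt_of_le_of_ne (Finset.sum_nonneg fun _ _ => hJ0 _)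
          (margZ_ne_zero hJ0 (hpos q hq).ne').symm))
    rw [hterm]
    simp only
    rw [prod_apply_eq_exp hn y hpos, prod_apply_eq_exp hn y hpos', sum_mul_log_eq_neg_add hac,
      ← mul_assoc (Real.exp _), ← Real.exp_add]
    congr 2
    ring
  have hexp : ∀ Q, (∀ q, J q = 0 → Q q = 0) →
      expNeg n (div Q J + max ((R : EReal) - fInfo Q J) 0) =
        (Real.exp (-(n * ∑ q, Q q * Real.log (Q q / J q))) *
          min 1 (Real.exp (n * ∑ q, Q q * Real.log (densityRatio J q)) /
            Real.exp (n * R)) : ℝ) := by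
    intro Q hac
    rw [div_of_ac hac, fInfo_of_ac hJ0 hac, expNeg_add_max]
  rw [hS, expIID]
  refine expNeg_iInf_bounds hn (typeLoss_pos n).le (by norm_num) (card_typeFinset_le n)
    (Finset.sum_nonneg fun Q _ => hG0 Q) (fun Q hQ => ?_) fun Q hQ => ?_
  · by_cases hac : ∀ q, J q = 0 → Q q = 0
    · rw [hexp Q hac, EReal.coe_le_coe_iff]
      refine le_trans ?_ (mul_le_mul_of_nonneg_left
        (Finset.single_le_sum (fun Q _ => hG0 Q) ((mem_typeFinset hn).2 hQ)) (typeLoss_pos n).le)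
      rw [hval Q hQ hac]
      have h1 : 1 ≤ typeLoss (X × Z) n * (typeClass n Q).ncard * Real.exp (-(n * entropy Q)) := by
        rw [Real.exp_neg, ← div_eq_mul_inv, le_div_iff₀ (Real.exp_pos _), one_mul]
        exact exp_entropy_le hn hQ
      have h2 : Real.exp (-(n * ∑ q, Q q * Real.log (Q q / J q))) *
          min 1 (Real.exp (n * ∑ q, Q q * Real.log (densityRatio J q)) / Real.exp (n * R)) ≤
          Real.exp (-(n * ∑ q, Q q * Real.log (Q q / J q))) *
          min 1 (Real.exp (n * ∑ q, Q q * Real.log (densityRatio J q)) / M) :=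
        mul_le_mul_of_nonneg_left (min_le_min le_rfl
          (div_le_div_of_nonneg_left (Real.exp_nonneg _) hM0 (codeSize_le n R))) (Real.exp_nonneg _)
      refine h2.trans ?_
      have h3 : 0 ≤ Real.exp (-(n * ∑ q, Q q * Real.log (Q q / J q))) *
          min 1 (Real.exp (n * ∑ q, Q q * Real.log (densityRatio J q)) / M) :=
        mul_nonneg (Real.exp_nonneg _) (le_min zero_le_one (by positivity))
      calc _ ≤ _ := le_mul_of_one_le_left h3 h1
        _ = _ := by ring
    · rw [div_of_not_ac hac, EReal.top_add_of_ne_bot, expNeg_top hn]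
      · exact_mod_cast mul_nonneg (typeLoss_pos n).le (Finset.sum_nonneg fun Q _ => hG0 Q)
      · exact ne_bot_of_le_ne_bot EReal.zero_ne_bot (le_max_right _ _)
  · rw [mem_typeFinset hn] at hQ
    by_cases hac : ∀ q, J q = 0 → Q q = 0
    · refine Or.inr ⟨Q, hQ, ?_⟩
      rw [hexp Q hac, ← EReal.coe_mul, EReal.coe_le_coe_iff, hval Q hQ hac]
      have h1 : (typeClass n Q).ncard * Real.exp (-(n * entropy Q)) ≤ 1 := by
        rw [Real.exp_neg, ← div_eq_mul_inv, div_le_iff₀ (Real.exp_pos _), one_mul]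
        exact ncard_typeClass_le hn hQ
      have h3 : 0 ≤ Real.exp (-(n * ∑ q, Q q * Real.log (Q q / J q))) *
          min 1 (Real.exp (n * ∑ q, Q q * Real.log (densityRatio J q)) / M) :=
        mul_nonneg (Real.exp_nonneg _) (le_min zero_le_one (by positivity))
      rw [← mul_assoc]
      refine (mul_le_of_le_one_left h3 h1).trans ?_
      rw [mul_left_comm]
      refine mul_le_mul_of_nonneg_left ?_ (Real.exp_nonneg _)
      rw [mul_min_of_nonneg _ _ zero_le_two]
      refine min_le_min (by norm_num) ?_
      rw [← mul_div_assoc, div_le_div_iff₀ hM0 (Real.exp_pos _)]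
      have := exp_le_two_mul_codeSize hR n
      have h5 := Real.exp_pos (n * ∑ q, Q q * Real.log (densityRatio J q))
      nlinarith
    · refine Or.inl (Finset.sum_eq_zero fun y hy => ?_)
      obtain rfl := (Finset.mem_filter.1 hy).2
      push Not at hac
      obtain ⟨q, hq, hq'⟩ := hac
      obtain ⟨i, hi⟩ := exists_apply_eq_of_empirical_ne_zero hq'
      rw [hterm]
      simp only
      rw [Finset.prod_eq_zero (Finset.mem_univ i) (by rw [hi, hq]), zero_mul]

end IID

/-! ### The exponent of the constant-composition ensemble -/

section ConstantComposition

variable {X Z : Type*} {W V : X → Z → ℝ} {P : X → ℝ}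

lemma uniformOnType_nonneg (n : ℕ) (P : X → ℝ) (x : Fin n → X) : 0 ≤ uniformOnType n P x :=
  Set.indicator_nonneg (fun _ _ => by positivity) x

lemma uniformOnType_of_empirical {n : ℕ} {P : X → ℝ} {x : Fin n → X} (h : empirical x = P) :
    uniformOnType n P x = 1 / ((typeClass n P).ncard : ℝ) :=
  Set.indicator_of_mem (s := typeClass n P) h _

lemma uniformOnType_of_empirical_ne {n : ℕ} {P : X → ℝ} {x : Fin n → X} (h : empirical x ≠ P) :
    uniformOnType n P x = 0 :=
  Set.indicator_of_notMem (s := typeClass n P) h _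

/-- The probability of a pair of sequences under the constant-composition ensemble. -/
def pairProb (n : ℕ) (P : X → ℝ) (W : X → Z → ℝ) (y : Fin n → X × Z) : ℝ :=
  uniformOnType n P (Prod.fst ∘ y) * ∏ i, W (y i).1 (y i).2

lemma pairProb_eq_zero_of_not_ac {n : ℕ}
    (hac : ¬ ∀ q, joint P W q = 0 → joint P V q = 0) {y : Fin n → X × Z}
    (hy : empirical y = joint P V) : pairProb n P W y = 0 := by
  push Not at hac
  obtain ⟨q, hq, hq'⟩ := hac
  obtain ⟨i, hi⟩ := exists_apply_eq_of_empirical_ne_zero (hy ▸ hq')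
  have hP : P q.1 ≠ 0 := fun h => hq' (by simp [joint, h])
  have hWq : W q.1 q.2 = 0 := (mul_eq_zero.1 hq).resolve_left hP
  rw [pairProb, Finset.prod_eq_zero (Finset.mem_univ i) (by rw [hi, hWq]), mul_zero]

section

variable [Fintype Z]

lemma margX_empirical {n : ℕ} (y : Fin n → X × Z) :
    margX (empirical y) = empirical (Prod.fst ∘ y) := by
  ext x
  simp only [margX, empirical]
  rw [← Finset.sum_div, ← Nat.cast_sum]
  congr 2
  rw [← Nat.card_sigma]
  refine Nat.card_congr ⟨fun s => ⟨s.2.1, by simp [s.2.2]⟩, fun i => ⟨(y i.1).2, i.1, ?_⟩, ?_, ?_⟩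
  · exact Prod.ext i.2 rfl
  · rintro ⟨z, i, hi⟩
    have : (y i).2 = z := by rw [hi]
    subst this
    rfl
  · intro i
    rfl

/-- A joint distribution factors through its first marginal and a channel. -/
lemma exists_channel_joint_eq (hW : IsChannel W) {Q : X × Z → ℝ} (hQ : ∀ q, 0 ≤ Q q) :
    ∃ V, IsChannel V ∧ joint (margX Q) V = Q := by
  classical
  -- the rows of `W` fill in where the marginal vanishes
  refine ⟨fun x z => if margX Q x = 0 then W x z else Q (x, z) / margX Q x, fun x => ?_, ?_⟩
  · by_cases h : margX Q x = 0
    · simp only [h, if_true]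
      exact hW x
    · simp only [h, if_false]
      refine ⟨fun z => div_nonneg (hQ _) (Finset.sum_nonneg fun _ _ => hQ _), ?_⟩
      rw [← Finset.sum_div]
      exact div_self h
  · ext q
    simp only [joint]
    split_ifs with h
    · rw [h, zero_mul]
      by_contra hq
      exact margX_ne_zero hQ (Ne.symm hq) h
    · rw [mul_div_cancel₀ _ h]

lemma pairProb_nonneg (hW : IsChannel W) (n : ℕ) (y : Fin n → X × Z) : 0 ≤ pairProb n P W y :=
  mul_nonneg (uniformOnType_nonneg n P _) (Finset.prod_nonneg fun _ _ => (hW _).1 _)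

lemma pairProb_eq_zero {n : ℕ} {y : Fin n → X × Z} (h : margX (empirical y) ≠ P) :
    pairProb n P W y = 0 := by
  rw [pairProb, uniformOnType_of_empirical_ne (by rwa [← margX_empirical]), zero_mul]

end

variable [Fintype X]

lemma margZ_empirical {n : ℕ} (y : Fin n → X × Z) :
    margZ (empirical y) = empirical (Prod.snd ∘ y) := by
  ext z
  simp only [margZ, empirical]
  rw [← Finset.sum_div, ← Nat.cast_sum]
  congr 2
  rw [← Nat.card_sigma]
  refine Nat.card_congr ⟨fun s => ⟨s.2.1, by simp [s.2.2]⟩, fun i => ⟨(y i.1).1, i.1, ?_⟩, ?_, ?_⟩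
  · exact Prod.ext rfl i.2
  · rintro ⟨x, i, hi⟩
    have : (y i).1 = x := by rw [hi]
    subst this
    rfl
  · intro i
    rfl

lemma sum_uniformOnType {n : ℕ} (hn : 1 ≤ n) {P : X → ℝ} (hP : P ∈ types n X) :
    ∑ x, uniformOnType n P x = 1 := by
  classical
  have h : ∀ x, uniformOnType n P x =
      if empirical x = P then 1 / ((typeClass n P).ncard : ℝ) else 0 := by
    intro x
    split_ifs with hx
    · exact uniformOnType_of_empirical hx
    · exact uniformOnType_of_empirical_ne hx
  simp_rw [h]
  rw [← Finset.sum_filter, Finset.sum_const, nsmul_eq_mul, ← ncard_typeClass]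
  exact mul_one_div_cancel (ncard_typeClass_pos hn hP).ne'

/-- The output distribution of the constant-composition ensemble is permutation invariant. -/
lemma output_uniformOnType_comp (W : X → Z → ℝ) {n : ℕ} (P : X → ℝ) (z : Fin n → Z)
    (σ : Equiv.Perm (Fin n)) :
    output (uniformOnType n P) (powerChannel n W) (z ∘ σ) =
      output (uniformOnType n P) (powerChannel n W) z := by
  classical
  simp only [output]
  refine (Fintype.sum_equiv (σ.arrowCongr (Equiv.refl X)) _ _ fun x => ?_)
  have h1 : σ.arrowCongr (Equiv.refl X) x = x ∘ σ.symm := rfl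
  have h2 : uniformOnType n P (x ∘ σ.symm) = uniformOnType n P x := by
    by_cases h : empirical x = P
    · rw [uniformOnType_of_empirical h,
        uniformOnType_of_empirical ((empirical_comp_perm x σ.symm).trans h)]
    · rw [uniformOnType_of_empirical_ne h,
        uniformOnType_of_empirical_ne fun h' => h ((empirical_comp_perm x σ.symm).symm.trans h')]
  rw [h1, h2]
  congr 1
  simp only [powerChannel]
  exact Fintype.prod_equiv σ _ _ fun _ => by simp

variable [Fintype Z]

/-- Chain rule: `H(P × V) - H(P) + ω(V‖W|P) = -D(V‖W|P)`. -/
lemma entropy_joint_sub (hV : IsChannel V)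
    (hac : ∀ q, joint P W q = 0 → joint P V q = 0) :
    entropy (joint P V) - entropy P + ∑ q : X × Z, joint P V q * Real.log (W q.1 q.2) =
      -∑ q, joint P V q * Real.log (joint P V q / joint P W q) := by
  have hP : entropy P = -∑ q : X × Z, joint P V q * Real.log (P q.1) := by
    rw [entropy, Fintype.sum_prod_type]
    congr 1
    refine Finset.sum_congr rfl fun x _ => ?_
    simp only [joint]
    rw [← Finset.sum_mul, ← Finset.mul_sum, (hV x).2, mul_one]
  rw [hP, entropy, sub_neg_eq_add, ← Finset.sum_neg_distrib, ← Finset.sum_add_distrib,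
    ← Finset.sum_add_distrib, ← Finset.sum_neg_distrib]
  refine Finset.sum_congr rfl fun q _ => ?_
  rcases eq_or_ne (joint P V q) 0 with h | h
  · simp [h]
  · have hJ : joint P W q ≠ 0 := fun h0 => h (hac q h0)
    have hPq : P q.1 ≠ 0 := fun h0 => hJ (by simp [joint, h0])
    have hWq : W q.1 q.2 ≠ 0 := fun h0 => hJ (by simp [joint, h0])
    rw [Real.log_div h hJ, show joint P W q = P q.1 * W q.1 q.2 from rfl, Real.log_mul hPq hWq]
    ring

lemma omega_of_ac (hW : IsChannel W) (hac : ∀ q, joint P W q = 0 → joint P V q = 0) :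
    omega V W P = ((∑ q : X × Z, joint P V q * Real.log (W q.1 q.2) : ℝ) : EReal) := by
  refine sum_mul_elog (Q := joint P V) (F := fun q : X × Z => W q.1 q.2) fun q hq => ?_
  refine lt_of_le_of_ne ((hW _).1 _) fun h0 => hq (hac q ?_)
  simp [joint, ← h0]

lemma prod_channel_eq_exp (hW : IsChannel W) {n : ℕ} (hn : 1 ≤ n)
    (hac : ∀ q, joint P W q = 0 → joint P V q = 0)
    {y : Fin n → X × Z} (hy : empirical y = joint P V) :
    ∏ i, W (y i).1 (y i).2 = Real.exp (n * ∑ q : X × Z, joint P V q * Real.log (W q.1 q.2)) := by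
  rw [prod_apply_eq_exp hn y (F := fun q : X × Z => W q.1 q.2), hy]
  intro q hq
  rw [hy] at hq
  exact lt_of_le_of_ne ((hW _).1 _) fun h0 => hq (hac q (by simp [joint, ← h0]))

open Classical in
/-- The probability of a joint type `P × V` is `exp (-n D(V‖W|P))` up to polynomial factors. -/
lemma sum_pairProb_bounds (hW : IsChannel W) {n : ℕ} (hn : 1 ≤ n) (hP : P ∈ types n X)
    (hV : V ∈ typeChannels n P) (hac : ∀ q, joint P W q = 0 → joint P V q = 0) {d : ℝ}
    (hd : d = ∑ q, joint P V q * Real.log (joint P V q / joint P W q)) :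
    Real.exp (-(n * d)) ≤ typeLoss (X × Z) n *
        ∑ y ∈ Finset.univ.filter (fun y : Fin n → X × Z => empirical y = joint P V),
          pairProb n P W y ∧
      ∑ y ∈ Finset.univ.filter (fun y : Fin n → X × Z => empirical y = joint P V),
          pairProb n P W y ≤ typeLoss X n * Real.exp (-(n * d)) := by
  set ω := ∑ q : X × Z, joint P V q * Real.log (W q.1 q.2) with hω
  have hsum : ∑ y ∈ Finset.univ.filter (fun y : Fin n → X × Z => empirical y = joint P V),
      pairProb n P W y = (typeClass n (joint P V)).ncard *
        (1 / ((typeClass n P).ncard : ℝ) * Real.exp (n * ω)) := by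
    rw [ncard_typeClass n (joint P V), ← nsmul_eq_mul, ← Finset.sum_const]
    refine Finset.sum_congr rfl fun y hy => ?_
    have hy := (Finset.mem_filter.1 hy).2
    rw [pairProb, prod_channel_eq_exp hW hn hac hy, uniformOnType_of_empirical]
    rw [← margX_empirical, hy, margX_joint hV.1]
  have hchain := entropy_joint_sub hV.1 hac
  rw [← hω, ← hd] at hchain
  have hexp : Real.exp (-(n * d)) =
      Real.exp (n * entropy (joint P V)) / Real.exp (n * entropy P) * Real.exp (n * ω) := by
    rw [← Real.exp_sub, ← Real.exp_add]
    congr 1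
    rw [← mul_neg, ← hchain]
    ring
  have hpos := ncard_typeClass_pos hn hP
  have hJ0 : (0 : ℝ) ≤ (typeClass n (joint P V)).ncard := by positivity
  rw [hsum, hexp]
  constructor
  · calc Real.exp (n * entropy (joint P V)) / Real.exp (n * entropy P) * Real.exp (n * ω)
        ≤ (typeLoss (X × Z) n * (typeClass n (joint P V)).ncard) / (typeClass n P).ncard *
            Real.exp (n * ω) := by
          refine mul_le_mul_of_nonneg_right ?_ (Real.exp_nonneg _)
          exact div_le_div₀ (mul_nonneg (typeLoss_pos n).le hJ0) (exp_entropy_le hn hV.2) hpos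
            (ncard_typeClass_le hn hP)
      _ = _ := by ring
  · calc (typeClass n (joint P V)).ncard * (1 / ((typeClass n P).ncard : ℝ) * Real.exp (n * ω))
        = (typeClass n (joint P V)).ncard / ((typeClass n P).ncard : ℝ) * Real.exp (n * ω) := by
          ring
      _ ≤ typeLoss X n * (Real.exp (n * entropy (joint P V)) / Real.exp (n * entropy P)) *
            Real.exp (n * ω) := by
          refine mul_le_mul_of_nonneg_right ?_ (Real.exp_nonneg _)
          rw [← mul_div_assoc, div_le_div_iff₀ hpos (Real.exp_pos _)]
          have h1 := mul_le_mul (ncard_typeClass_le hn hV.2) (exp_entropy_le hn hP)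
            (Real.exp_nonneg _) (Real.exp_nonneg _)
          linarith
      _ = _ := by ring

lemma exists_typeChannel (hW : IsChannel W) {n : ℕ} {Q : X × Z → ℝ} (hQ : Q ∈ types n (X × Z)) :
    ∃ V ∈ typeChannels n (margX Q), joint (margX Q) V = Q := by
  obtain ⟨V, hV, hVQ⟩ := exists_channel_joint_eq hW hQ.1.1
  exact ⟨V, ⟨hV, by rwa [hVQ]⟩, hVQ⟩

open Classical in
/-- The probability of an output type is `exp (-n min D(V'‖W|P))`, up to polynomial factors. -/
lemma output_prob_bounds (hW : IsChannel W) {n : ℕ} (hn : 1 ≤ n) (hP : P ∈ types n X)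
    {z : Fin n → Z} :
    expNeg n (⨅ V' ∈ {V' ∈ typeChannels n P | output P V' = empirical z}, condDiv V' W P) ≤
        (typeLoss (X × Z) n * ((typeClass n (empirical z)).ncard *
          output (uniformOnType n P) (powerChannel n W) z) : ℝ) ∧
      (((typeClass n (empirical z)).ncard *
          output (uniformOnType n P) (powerChannel n W) z : ℝ) : EReal) ≤
        ((typeLoss X n * typeLoss (X × Z) n : ℝ) : EReal) *
          expNeg n (⨅ V' ∈ {V' ∈ typeChannels n P | output P V' = empirical z},
            condDiv V' W P) := by
  set G : (X × Z → ℝ) → ℝ := fun Q => if margZ Q = empirical z then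
    ∑ y ∈ Finset.univ.filter (fun y : Fin n → X × Z => empirical y = Q), pairProb n P W y else 0
    with hG
  have hG0 : ∀ Q, 0 ≤ G Q := fun Q => by
    rw [hG]
    simp only
    split_ifs
    · exact Finset.sum_nonneg fun y _ => pairProb_nonneg hW n y
    · exact le_rfl
  have hS : (typeClass n (empirical z)).ncard *
      output (uniformOnType n P) (powerChannel n W) z = ∑ Q ∈ typeFinset (X × Z) n, G Q := by
    rw [ncard_typeClass, ← nsmul_eq_mul, ← Finset.sum_const]
    calc ∑ z' ∈ Finset.univ.filter (fun z' : Fin n → Z => empirical z' = empirical z),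
          output (uniformOnType n P) (powerChannel n W) z
        = ∑ z' ∈ Finset.univ.filter (fun z' : Fin n → Z => empirical z' = empirical z),
          output (uniformOnType n P) (powerChannel n W) z' := by
          refine Finset.sum_congr rfl fun z' hz' => ?_
          obtain ⟨σ, rfl⟩ := exists_perm_of_empirical_eq hn (Finset.mem_filter.1 hz').2.symm
          exact (output_uniformOnType_comp W P z σ).symm
      _ = ∑ x, ∑ z' : Fin n → Z, if empirical z' = empirical z then
            uniformOnType n P x * powerChannel n W x z' else 0 := by
          rw [Finset.sum_filter, Finset.sum_comm]
          refine Finset.sum_congr rfl fun z' _ => ?_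
          split_ifs
          · rfl
          · simp
      _ = ∑ y : Fin n → X × Z,
            if margZ (empirical y) = empirical z then pairProb n P W y else 0 := by
          rw [sum_sum_eq_sum_pairs n fun x z' => if empirical z' = empirical z then
            uniformOnType n P x * powerChannel n W x z' else 0]
          refine Finset.sum_congr rfl fun y _ => ?_
          rw [margZ_empirical]
          rfl
      _ = _ := by
          rw [sum_eq_sum_typeFinset]
          refine Finset.sum_congr rfl fun Q _ => ?_
          rw [hG]
          simp only
          split_ifs with h
          · refine Finset.sum_congr rfl fun y hy => ?_
            rw [(Finset.mem_filter.1 hy).2, if_pos h]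
          · refine Finset.sum_eq_zero fun y hy => ?_
            rw [(Finset.mem_filter.1 hy).2, if_neg h]
  have hcond : ∀ V : X → Z → ℝ, (∀ q, joint P W q = 0 → joint P V q = 0) →
      expNeg n (condDiv V W P) =
        (Real.exp (-(n * ∑ q, joint P V q * Real.log (joint P V q / joint P W q))) : ℝ) := by
    intro V hac
    rw [condDiv, div_of_ac hac, expNeg_coe]
  rw [hS]
  refine expNeg_iInf_bounds hn (typeLoss_pos n).le (typeLoss_pos n).le (card_typeFinset_le n)
    (Finset.sum_nonneg fun Q _ => hG0 Q) (fun V hV => ?_) fun Q hQ => ?_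
  · by_cases hac : ∀ q, joint P W q = 0 → joint P V q = 0
    · rw [hcond V hac, EReal.coe_le_coe_iff]
      refine (sum_pairProb_bounds hW hn hP hV.1 hac rfl).1.trans ?_
      have hGV : G (joint P V) = ∑ y ∈ Finset.univ.filter
          (fun y : Fin n → X × Z => empirical y = joint P V), pairProb n P W y := if_pos hV.2
      rw [← hGV]
      exact mul_le_mul_of_nonneg_left
        (Finset.single_le_sum (fun Q _ => hG0 Q) ((mem_typeFinset hn).2 hV.1.2)) (typeLoss_pos n).le
    · rw [condDiv, div_of_not_ac hac, expNeg_top hn]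
      exact_mod_cast mul_nonneg (typeLoss_pos n).le (Finset.sum_nonneg fun Q _ => hG0 Q)
  · rw [mem_typeFinset hn] at hQ
    by_cases hQP : margX Q = P
    · by_cases hQz : margZ Q = empirical z
      · obtain ⟨V, hV, hVQ⟩ := exists_typeChannel hW hQ
        rw [hQP] at hV hVQ
        subst hVQ
        have hGV : G (joint P V) = ∑ y ∈ Finset.univ.filter
          (fun y : Fin n → X × Z => empirical y = joint P V), pairProb n P W y := if_pos hQz
        by_cases hac : ∀ q, joint P W q = 0 → joint P V q = 0
        · refine Or.inr ⟨V, ⟨hV, hQz⟩, ?_⟩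
          rw [hcond V hac, ← EReal.coe_mul, EReal.coe_le_coe_iff, hGV]
          exact (sum_pairProb_bounds hW hn hP hV hac rfl).2
        · left
          rw [hGV]
          exact Finset.sum_eq_zero fun y hy =>
            pairProb_eq_zero_of_not_ac hac (Finset.mem_filter.1 hy).2
      · exact Or.inl (if_neg hQz)
    · left
      rw [hG]
      simp only
      split_ifs
      · refine Finset.sum_eq_zero fun y hy => pairProb_eq_zero ?_
        rwa [(Finset.mem_filter.1 hy).2]
      · rfl

/-- The infimum in `gInfo` is a real number `a`, and `exp (-n (H(P ∘ V) + a))` is the probability of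
an output sequence of type `P ∘ V` up to polynomial factors. -/
lemma exists_output_bounds (hW : IsChannel W) {n : ℕ} (hn : 1 ≤ n) (hP : P ∈ types n X)
    (hV : V ∈ typeChannels n P) (hac : ∀ q, joint P W q = 0 → joint P V q = 0) :
    ∃ a : ℝ, (⨅ V' ∈ {V' ∈ typeChannels n P | output P V' = output P V}, condDiv V' W P) = a ∧
      ∀ z : Fin n → Z, empirical z = output P V →
        Real.exp (-(n * (entropy (output P V) + a))) ≤ typeLoss (X × Z) n *
          output (uniformOnType n P) (powerChannel n W) z ∧
        output (uniformOnType n P) (powerChannel n W) z ≤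
          typeLoss X n * typeLoss (X × Z) n * typeLoss Z n *
            Real.exp (-(n * (entropy (output P V) + a))) := by
  have hz0 : ∃ z : Fin n → Z, empirical z = output P V := by
    obtain ⟨y, hy⟩ := exists_empirical_eq hn hV.2
    exact ⟨Prod.snd ∘ y, by rw [← margZ_empirical, hy, margZ_joint]⟩
  obtain ⟨a, ha⟩ : ∃ a : ℝ, (⨅ V' ∈ {V' ∈ typeChannels n P | output P V' = output P V},
      condDiv V' W P) = a := by
    have htop : (⨅ V' ∈ {V' ∈ typeChannels n P | output P V' = output P V},
        condDiv V' W P) ≠ ⊤ := by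
      have h1 : (⨅ V' ∈ {V' ∈ typeChannels n P | output P V' = output P V}, condDiv V' W P) ≤
        condDiv V W P := iInf₂_le V ⟨hV, rfl⟩
      refine ne_top_of_le_ne_top ?_ h1
      rw [condDiv, div_of_ac hac]
      exact EReal.coe_ne_top _
    have hbot : (⨅ V' ∈ {V' ∈ typeChannels n P | output P V' = output P V},
        condDiv V' W P) ≠ ⊥ := by
      intro h
      obtain ⟨z, hz⟩ := hz0
      have h1 := (output_prob_bounds hW hn hP (z := z)).1
      rw [hz, h, expNeg_bot hn] at h1
      exact EReal.coe_ne_top _ (top_le_iff.1 h1)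
    exact ⟨_, (EReal.coe_toReal htop hbot).symm⟩
  refine ⟨a, ha, fun z hz => ?_⟩
  obtain ⟨h1, h2⟩ := output_prob_bounds hW hn hP (z := z)
  rw [hz, ha, expNeg_coe] at h1 h2
  rw [EReal.coe_le_coe_iff] at h1
  rw [← EReal.coe_mul, EReal.coe_le_coe_iff] at h2
  have hT : output P V ∈ types n Z := hz ▸ empirical_mem_types hn z
  have hN1 := ncard_typeClass_le hn hT
  have hN2 := exp_entropy_le hn hT
  set N : ℝ := ((typeClass n (output P V)).ncard : ℝ)
  set p := output (uniformOnType n P) (powerChannel n W) z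
  have hp : 0 ≤ p := output_nonneg (uniformOnType_nonneg n P) (powerChannel_nonneg hW n) z
  have hE : Real.exp (-(n * (entropy (output P V) + a))) =
      Real.exp (-(n * a)) / Real.exp (n * entropy (output P V)) := by
    rw [← Real.exp_sub]
    congr 1
    ring
  have hH := Real.exp_pos (n * entropy (output P V))
  have hκ := typeLoss_pos (A := X × Z) n
  have hκX := typeLoss_pos (A := X) n
  have hκZ := typeLoss_pos (A := Z) n
  rw [hE]
  constructor
  · rw [div_le_iff₀ hH]
    refine h1.trans ?_
    rw [mul_assoc]
    refine mul_le_mul_of_nonneg_left ?_ hκ.le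
    rw [mul_comm]
    exact mul_le_mul_of_nonneg_left hN1 hp
  · rw [← mul_div_assoc, le_div_iff₀ hH]
    calc p * Real.exp (n * entropy (output P V)) ≤ p * (typeLoss Z n * N) :=
          mul_le_mul_of_nonneg_left hN2 hp
      _ = typeLoss Z n * (N * p) := by ring
      _ ≤ typeLoss Z n * (typeLoss X n * typeLoss (X × Z) n * Real.exp (-(n * a))) :=
          mul_le_mul_of_nonneg_left h2 hκZ.le
      _ = _ := by ring

open Classical in
/-- The truncated mean of the constant-composition ensemble is `exp (-n E)` up to a polynomial
factor, by summing over the joint types. -/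
lemma expCC_bounds (hW : IsChannel W) {R : ℝ} (hR : 0 ≤ R) {n : ℕ} (hn : 1 ≤ n)
    (hP : P ∈ types n X) :
    expNeg n (expCC n P W R) ≤ ((typeLoss X n * typeLoss (X × Z) n ^ 2 * typeLoss Z n *
        truncatedMean (uniformOnType n P) (powerChannel n W) (codeSize n R) : ℝ) : EReal) ∧
      ((truncatedMean (uniformOnType n P) (powerChannel n W) (codeSize n R) : ℝ) : EReal) ≤
        ((2 * (typeLoss X n * typeLoss (X × Z) n) * typeLoss (X × Z) n : ℝ) : EReal) *
          expNeg n (expCC n P W R) := by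
  set M := codeSize n R
  have hM0 : (0 : ℝ) < M := by exact_mod_cast one_le_codeSize hR n
  set pbar := output (uniformOnType n P) (powerChannel n W) with hpbar
  have hpbar0 : ∀ z, 0 ≤ pbar z :=
    output_nonneg (uniformOnType_nonneg n P) (powerChannel_nonneg hW n)
  have hκ := typeLoss_pos (A := X × Z) n
  have hκX := typeLoss_pos (A := X) n
  have hκZ := typeLoss_pos (A := Z) n
  set term : (Fin n → X × Z) → ℝ := fun y => pairProb n P W y *
        min 1 ((∏ i, W (y i).1 (y i).2) / (M * pbar (Prod.snd ∘ y))) with hterm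
  have hterm0 : ∀ y, 0 ≤ term y := fun y =>
    mul_nonneg (pairProb_nonneg hW n y) (le_min zero_le_one
      (div_nonneg (Finset.prod_nonneg fun i _ => (hW _).1 _) (mul_nonneg hM0.le (hpbar0 _))))
  set G : (X × Z → ℝ) → ℝ := fun Q =>
    ∑ y ∈ Finset.univ.filter (fun y : Fin n → X × Z => empirical y = Q), term y with hG
  have hG0 : ∀ Q, 0 ≤ G Q := fun Q => Finset.sum_nonneg fun y _ => hterm0 y
  have hS : truncatedMean (uniformOnType n P) (powerChannel n W) M =
      ∑ Q ∈ typeFinset (X × Z) n, G Q := by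
    rw [← sum_eq_sum_typeFinset, truncatedMean,
      sum_sum_eq_sum_pairs n fun x z => uniformOnType n P x * powerChannel n W x z *
        min 1 (powerChannel n W x z / (M * output (uniformOnType n P) (powerChannel n W) z))]
    rfl
  -- the contribution of a joint type `P × V` is `exp (-n (D + [R - g]⁺))`
  have key : ∀ V ∈ typeChannels n P, (∀ q, joint P W q = 0 → joint P V q = 0) →
      expNeg n (condDiv V W P + max ((R : EReal) - gInfo n V W P) 0) ≤
          ((typeLoss X n * typeLoss (X × Z) n ^ 2 * typeLoss Z n * G (joint P V) : ℝ) : EReal) ∧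
        (G (joint P V) : EReal) ≤ ((2 * (typeLoss X n * typeLoss (X × Z) n) : ℝ) : EReal) *
          expNeg n (condDiv V W P + max ((R : EReal) - gInfo n V W P) 0) := by
    intro V hV hac
    obtain ⟨a, ha, hz⟩ := exists_output_bounds hW hn hP hV hac
    obtain ⟨hm1, hm2⟩ := sum_pairProb_bounds hW hn hP hV hac rfl
    set d := ∑ q, joint P V q * Real.log (joint P V q / joint P W q) with hd
    set ω := ∑ q : X × Z, joint P V q * Real.log (W q.1 q.2) with hω
    set m := ∑ y ∈ Finset.univ.filter (fun y : Fin n → X × Z => empirical y = joint P V),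
          pairProb n P W y with hmdef
    set g := ω + entropy (output P V) + a with hg
    have hgI : gInfo n V W P = (g : EReal) := by
      rw [gInfo, omega_of_ac hW hac, ha, hg, EReal.coe_add, EReal.coe_add]
    have hcd : condDiv V W P = (d : EReal) := div_of_ac hac
    rw [hgI, hcd, expNeg_add_max]
    have hgexp : Real.exp (n * ω) = Real.exp (n * g) *
        Real.exp (-(n * (entropy (output P V) + a))) := by
      rw [← Real.exp_add]
      congr 1
      rw [hg]
      ring
    -- on the joint type of `V` the likelihood ratio is `exp (n g)` up to polynomial factors
    have hprod : ∀ y : Fin n → X × Z, empirical y = joint P V →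
        1 / (typeLoss X n * typeLoss (X × Z) n * typeLoss Z n) *
            min 1 (Real.exp (n * g) / Real.exp (n * R)) ≤
          min 1 ((∏ i, W (y i).1 (y i).2) / (M * pbar (Prod.snd ∘ y))) ∧
        min 1 ((∏ i, W (y i).1 (y i).2) / (M * pbar (Prod.snd ∘ y))) ≤
          2 * typeLoss (X × Z) n * min 1 (Real.exp (n * g) / Real.exp (n * R)) := by
      intro y hy
      have hyz : empirical (Prod.snd ∘ y) = output P V := by
        rw [← margZ_empirical, hy, margZ_joint]
      obtain ⟨h1, h2⟩ := hz _ hyz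
      rw [← hpbar] at h1 h2
      set e := Real.exp (-(n * (entropy (output P V) + a)))
      have he0 : 0 < e := Real.exp_pos _
      set p := pbar (Prod.snd ∘ y)
      have hp0 : 0 < p := pos_of_mul_pos_right (he0.trans_le h1) hκ.le
      rw [prod_channel_eq_exp hW hn hac hy, hgexp]
      set t := Real.exp (n * g)
      have ht0 : 0 < t := Real.exp_pos _
      set C := typeLoss X n * typeLoss (X × Z) n * typeLoss Z n
      have hC1 : 1 ≤ C := one_le_mul_of_one_le_of_one_le
        (one_le_mul_of_one_le_of_one_le (one_le_typeLoss n) (one_le_typeLoss n)) (one_le_typeLoss n)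
      have hC0 : 0 < C := by linarith
      constructor
      · rw [mul_min_of_nonneg _ _ (by positivity), mul_one]
        refine min_le_min ((div_le_one hC0).2 hC1) ?_
        rw [div_mul_div_comm, one_mul, div_le_div_iff₀ (by positivity) (by positivity)]
        calc t * (M * p) ≤ t * (Real.exp (n * R) * (C * e)) :=
              mul_le_mul_of_nonneg_left
                (mul_le_mul (codeSize_le n R) h2 hp0.le (Real.exp_nonneg _)) ht0.le
          _ = t * e * (C * Real.exp (n * R)) := by ring
      · rw [mul_min_of_nonneg _ _ (by positivity), mul_one]
        refine min_le_min ?_ ?_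
        · have := one_le_typeLoss (A := X × Z) n
          linarith
        · rw [← mul_div_assoc, div_le_div_iff₀ (by positivity) (Real.exp_pos _)]
          calc t * e * Real.exp (n * R) ≤ t * (typeLoss (X × Z) n * p) * (2 * M) :=
                mul_le_mul (mul_le_mul_of_nonneg_left h1 ht0.le) (exp_le_two_mul_codeSize hR n)
                  (Real.exp_nonneg _) (by positivity)
            _ = 2 * typeLoss (X × Z) n * t * (M * p) := by ring
    set b := min 1 (Real.exp (n * g) / Real.exp (n * R))
    have hb0 : 0 ≤ b := le_min zero_le_one (by positivity)
    constructor
    · rw [EReal.coe_le_coe_iff]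
      have hGlow : m * (1 / (typeLoss X n * typeLoss (X × Z) n * typeLoss Z n) * b) ≤
          G (joint P V) := by
        rw [hmdef, Finset.sum_mul]
        exact Finset.sum_le_sum fun y hy => mul_le_mul_of_nonneg_left
          (hprod y (Finset.mem_filter.1 hy).2).1 (pairProb_nonneg hW n y)
      calc Real.exp (-(n * d)) * b ≤ typeLoss (X × Z) n * m * b :=
            mul_le_mul_of_nonneg_right hm1 hb0
        _ = typeLoss X n * typeLoss (X × Z) n ^ 2 * typeLoss Z n *
            (m * (1 / (typeLoss X n * typeLoss (X × Z) n * typeLoss Z n) * b)) := by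
            field_simp
        _ ≤ _ := mul_le_mul_of_nonneg_left hGlow (by positivity)
    · rw [← EReal.coe_mul, EReal.coe_le_coe_iff]
      have hGup : G (joint P V) ≤ m * (2 * typeLoss (X × Z) n * b) := by
        rw [hmdef, Finset.sum_mul]
        exact Finset.sum_le_sum fun y hy => mul_le_mul_of_nonneg_left
          (hprod y (Finset.mem_filter.1 hy).2).2 (pairProb_nonneg hW n y)
      calc G (joint P V) ≤ m * (2 * typeLoss (X × Z) n * b) := hGup
        _ ≤ (typeLoss X n * Real.exp (-(n * d))) * (2 * typeLoss (X × Z) n * b) :=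
            mul_le_mul_of_nonneg_right hm2 (by positivity)
        _ = _ := by ring
  rw [hS, expCC]
  refine expNeg_iInf_bounds hn (by positivity) (by positivity) (card_typeFinset_le n)
    (Finset.sum_nonneg fun Q _ => hG0 Q) (fun V hV => ?_) fun Q hQ => ?_
  · by_cases hac : ∀ q, joint P W q = 0 → joint P V q = 0
    · refine (key V hV hac).1.trans ?_
      rw [EReal.coe_le_coe_iff]
      exact mul_le_mul_of_nonneg_left
        (Finset.single_le_sum (fun Q _ => hG0 Q) ((mem_typeFinset hn).2 hV.2)) (by positivity)
    · rw [condDiv, div_of_not_ac hac, EReal.top_add_of_ne_bot, expNeg_top hn]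
      · exact_mod_cast mul_nonneg (by positivity) (Finset.sum_nonneg fun Q _ => hG0 Q)
      · exact ne_bot_of_le_ne_bot EReal.zero_ne_bot (le_max_right _ _)
  · rw [mem_typeFinset hn] at hQ
    by_cases hQP : margX Q = P
    · obtain ⟨V, hV, hVQ⟩ := exists_typeChannel hW hQ
      rw [hQP] at hV hVQ
      subst hVQ
      by_cases hac : ∀ q, joint P W q = 0 → joint P V q = 0
      · exact Or.inr ⟨V, hV, (key V hV hac).2⟩
      · refine Or.inl (Finset.sum_eq_zero fun y hy => ?_)
        rw [hterm]
        simp only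
        rw [pairProb_eq_zero_of_not_ac hac (Finset.mem_filter.1 hy).2, zero_mul]
    · refine Or.inl (Finset.sum_eq_zero fun y hy => ?_)
      rw [hterm]
      simp only
      rw [pairProb_eq_zero, zero_mul]
      rwa [(Finset.mem_filter.1 hy).2]

end ConstantComposition

/-! ### Hellinger affinity and mutual information -/

section Hellinger

variable {A : Type*} [Fintype A]

/-- The Hellinger affinity (Bhattacharyya coefficient) of two distributions. -/
def affinity (p q : A → ℝ) : ℝ := ∑ a, √(p a * q a)

lemma affinity_nonneg (p q : A → ℝ) : 0 ≤ affinity p q :=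
  Finset.sum_nonneg fun _ _ => Real.sqrt_nonneg _

lemma sum_sqrt_sub_sq {p q : A → ℝ} (hp : p ∈ stdSimplex ℝ A) (hq : q ∈ stdSimplex ℝ A) :
    ∑ a, (√(p a) - √(q a)) ^ 2 = 2 * (1 - affinity p q) := by
  have : ∀ a, (√(p a) - √(q a)) ^ 2 = p a + q a - 2 * √(p a * q a) := by
    intro a
    rw [sub_sq, Real.sq_sqrt (hp.1 a), Real.sq_sqrt (hq.1 a), Real.sqrt_mul (hp.1 a)]
    ring
  simp_rw [this, Finset.sum_sub_distrib, Finset.sum_add_distrib, ← Finset.mul_sum, hp.2, hq.2]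
  rw [affinity]
  ring

lemma affinity_le_one {p q : A → ℝ} (hp : p ∈ stdSimplex ℝ A) (hq : q ∈ stdSimplex ℝ A) :
    affinity p q ≤ 1 := by
  have h := sum_sqrt_sub_sq hp hq
  have : 0 ≤ ∑ a, (√(p a) - √(q a)) ^ 2 := Finset.sum_nonneg fun _ _ => sq_nonneg _
  linarith

lemma eq_of_sum_sqrt_sub_sq_le {p q : A → ℝ} (hp : ∀ a, 0 ≤ p a) (hq : ∀ a, 0 ≤ q a)
    (h : ∑ a, (√(p a) - √(q a)) ^ 2 ≤ 0) : p = q := by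
  ext a
  have h0 := (Finset.sum_eq_zero_iff_of_nonneg fun a _ => sq_nonneg (√(p a) - √(q a))).1
    (le_antisymm h (Finset.sum_nonneg fun _ _ => sq_nonneg _)) a (Finset.mem_univ a)
  have h1 : √(p a) = √(q a) := sub_eq_zero.1 (pow_eq_zero_iff two_ne_zero |>.1 h0)
  exact (Real.sqrt_inj (hp a) (hq a)).1 h1

lemma affinity_lt_one {p q : A → ℝ} (hp : p ∈ stdSimplex ℝ A) (hq : q ∈ stdSimplex ℝ A)
    (hne : p ≠ q) : affinity p q < 1 := by
  by_contra! h
  have h2 := sum_sqrt_sub_sq hp hq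
  exact hne (eq_of_sum_sqrt_sub_sq_le hp.1 hq.1 (by linarith))

/-- The divergence is at least the squared Hellinger distance. -/
lemma sum_sqrt_sub_sq_le_div {p q : A → ℝ} (hp : p ∈ stdSimplex ℝ A) (hq : q ∈ stdSimplex ℝ A)
    (hac : ∀ a, q a = 0 → p a = 0) :
    ∑ a, (√(p a) - √(q a)) ^ 2 ≤ ∑ a, p a * Real.log (p a / q a) := by
  have key : ∀ a, 2 * p a - 2 * √(p a * q a) ≤ p a * Real.log (p a / q a) := by
    intro a
    rcases (hp.1 a).eq_or_lt with h | h
    · simp [← h]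
    have hqa : 0 < q a := lt_of_le_of_ne (hq.1 a) fun h0 => h.ne' (hac a h0.symm)
    have h1 := Real.log_le_sub_one_of_pos (Real.sqrt_pos.2 (div_pos hqa h))
    rw [Real.log_sqrt (div_pos hqa h).le] at h1
    have h2 : Real.log (p a / q a) = -Real.log (q a / p a) := by
      rw [← Real.log_inv, inv_div]
    have h3 : p a * √(q a / p a) = √(p a * q a) := by
      rw [← Real.sqrt_sq h.le, ← Real.sqrt_mul (sq_nonneg _), Real.sqrt_sq h.le]
      congr 1
      field_simp
    rw [h2]
    nlinarith [mul_le_mul_of_nonneg_left h1 h.le]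
  rw [sum_sqrt_sub_sq hp hq]
  refine le_trans (le_of_eq ?_) (Finset.sum_le_sum fun a _ => key a)
  rw [Finset.sum_sub_distrib, ← Finset.mul_sum, ← Finset.mul_sum, hp.2, affinity]
  ring

end Hellinger

section MutualInfo

variable {X Z : Type*} [Fintype X] [Fintype Z] {W : X → Z → ℝ} {P : X → ℝ}

lemma output_mem_stdSimplex (hP : P ∈ stdSimplex ℝ X) (hW : IsChannel W) :
    output P W ∈ stdSimplex ℝ Z :=
  ⟨output_nonneg hP.1 fun x => (hW x).1, sum_output hP.2 fun x => (hW x).2⟩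

lemma mutualInfo_eq (hP : P ∈ stdSimplex ℝ X) (hW : IsChannel W) :
    mutualInfo P W = ((∑ q : X × Z, joint P W q * Real.log (joint P W q /
      (margX (joint P W) q.1 * margZ (joint P W) q.2)) : ℝ) : EReal) := by
  refine div_of_ac fun q hq => ?_
  have hJ := (joint_mem_stdSimplex hP hW).1
  by_contra h
  exact mul_ne_zero (margX_ne_zero hJ h) (margZ_ne_zero hJ h) hq

/-- The mutual information vanishes only if the output does not depend on the input. -/
lemma apply_eq_output_of_mutualInfo_eq_zero (hP : P ∈ stdSimplex ℝ X) (hW : IsChannel W)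
    (h : mutualInfo P W = 0) {x : X} (hx : P x ≠ 0) : W x = output P W := by
  have hJ := joint_mem_stdSimplex hP hW
  have ho := output_mem_stdSimplex hP hW
  rw [mutualInfo_eq hP hW, EReal.coe_eq_zero] at h
  have hprod : (fun q : X × Z => margX (joint P W) q.1 * margZ (joint P W) q.2) ∈
      stdSimplex ℝ (X × Z) := by
    rw [margX_joint hW, margZ_joint]
    exact joint_mem_stdSimplex (W := fun _ => output P W) hP fun _ => ho
  have h1 := sum_sqrt_sub_sq_le_div hJ hprod fun q hq => by
    by_contra h
    exact mul_ne_zero (margX_ne_zero hJ.1 h) (margZ_ne_zero hJ.1 h) hq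
  have h2 := eq_of_sum_sqrt_sub_sq_le hJ.1 hprod.1 (h1.trans h.le)
  ext z
  have h3 := congrFun h2 (x, z)
  rw [margX_joint hW, margZ_joint] at h3
  exact mul_left_cancel₀ hx h3

lemma exists_ne_output_of_mutualInfo_pos (hP : P ∈ stdSimplex ℝ X) (hW : IsChannel W)
    (h : 0 < mutualInfo P W) : ∃ x, P x ≠ 0 ∧ W x ≠ output P W := by
  by_contra! hall
  refine h.ne' ?_
  rw [mutualInfo_eq hP hW, EReal.coe_eq_zero]
  refine Finset.sum_eq_zero fun q _ => ?_
  rw [margX_joint hW, margZ_joint]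
  rcases eq_or_ne (joint P W q) 0 with h0 | h0
  · rw [h0, zero_mul]
  · have hx : P q.1 ≠ 0 := fun hx => h0 (by simp [joint, hx])
    have : joint P W q = P q.1 * output P W q.2 := by
      rw [← hall q.1 hx]
      rfl
    rw [← this, div_self h0, Real.log_one, mul_zero]

end MutualInfo

/-! ### Large likelihood ratios are likely -/

section LikelihoodRatio

variable {Ω Y : Type*} [Fintype Ω] [Fintype Y] {P : Ω → ℝ} {U : Ω → Y → ℝ}

open Classical in
/-- Chernoff's bound with exponent one half, for a majorant `κ q` of the output distribution. -/
lemma half_le_sum_ite (hP0 : ∀ x, 0 ≤ P x) (hP : ∑ x, P x = 1) (hU0 : ∀ x y, 0 ≤ U x y)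
    (hU : ∀ x, ∑ y, U x y = 1) {q : Y → ℝ} {κ : ℝ} (hκ : 0 ≤ κ)
    (hle : ∀ y, output P U y ≤ κ * q y)
    (h : √(2 * κ) * ∑ x, P x * affinity (U x) q ≤ 1 / 2) :
    1 / 2 ≤ ∑ x, ∑ y, if 2 * output P U y ≤ U x y then P x * U x y else 0 := by
  have hterm : ∀ x y, P x * U x y ≤ (if 2 * output P U y ≤ U x y then P x * U x y else 0) +
      √(2 * κ) * (P x * √(U x y * q y)) := by
    intro x y
    have hnn : 0 ≤ √(2 * κ) * (P x * √(U x y * q y)) :=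
      mul_nonneg (Real.sqrt_nonneg _) (mul_nonneg (hP0 x) (Real.sqrt_nonneg _))
    split_ifs with h
    · linarith
    · rw [zero_add, mul_left_comm]
      refine mul_le_mul_of_nonneg_left ?_ (hP0 x)
      have h1 : U x y ≤ 2 * κ * q y := by
        have := hle y
        linarith
      rw [← Real.sqrt_mul (by positivity)]
      refine Real.le_sqrt_of_sq_le ?_
      have := mul_le_mul_of_nonneg_left h1 (hU0 x y)
      linarith
  have hsum := Finset.sum_le_sum fun x (_ : x ∈ (Finset.univ : Finset Ω)) =>
    Finset.sum_le_sum fun y (_ : y ∈ (Finset.univ : Finset Y)) => hterm x y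
  simp_rw [Finset.sum_add_distrib] at hsum
  rw [sum_mul_channel hP hU] at hsum
  have : ∑ x, ∑ y, √(2 * κ) * (P x * √(U x y * q y)) =
      √(2 * κ) * ∑ x, P x * affinity (U x) q := by
    simp_rw [affinity, Finset.mul_sum]
  linarith

variable {X Z : Type*} [Fintype Z] {W : X → Z → ℝ}

lemma affinity_powerChannel (hW : IsChannel W) {Q : Z → ℝ} (hQ : ∀ z, 0 ≤ Q z) {n : ℕ}
    (x : Fin n → X) :
    affinity (powerChannel n W x) (fun z => ∏ i, Q (z i)) = ∏ i, affinity (W (x i)) Q := by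
  simp only [affinity, powerChannel]
  rw [← sum_pi_prod fun i z => √(W (x i) z * Q z)]
  refine Finset.sum_congr rfl fun z _ => ?_
  rw [← Finset.prod_mul_distrib,
    Real.sqrt_prod _ fun i _ => mul_nonneg ((hW _).1 _) (hQ _)]

end LikelihoodRatio

/-! ### Subexponential factors -/

section Subexp

lemma subexponential_poly {C : ℝ} (hC : 0 < C) (d : ℕ) :
    Subexponential fun n => C * ((n : ℝ) + 1) ^ d := by
  refine ⟨fun n => by positivity, ?_⟩
  have h1 : Tendsto (fun n : ℕ => 1 / (n : ℝ) * Real.log ((n : ℝ) + 1)) atTop (𝓝 0) := by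
    have h := (Real.tendsto_pow_log_div_mul_add_atTop 1 (-1) 1 one_ne_zero).comp
      ((tendsto_natCast_atTop_atTop (R := ℝ)).atTop_add (tendsto_const_nhds (x := (1 : ℝ))))
    refine h.congr fun n => ?_
    simp only [Function.comp_apply, pow_one]
    rw [show 1 * ((n : ℝ) + 1) + -1 = n by ring]
    ring
  have h2 : Tendsto (fun n : ℕ => 1 / (n : ℝ)) atTop (𝓝 0) := tendsto_one_div_atTop_nhds_zero_nat
  have h3 := (h2.mul_const (Real.log C)).add (h1.const_mul (d : ℝ))
  rw [zero_mul, mul_zero, add_zero] at h3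
  refine h3.congr fun n => ?_
  rw [Real.log_mul hC.ne' (by positivity), Real.log_pow]
  ring

lemma Subexponential.eventually_le_exp {p : ℕ → ℝ} (hp : Subexponential p) {δ : ℝ} (hδ : 0 < δ) :
    ∀ᶠ n : ℕ in atTop, p n ≤ Real.exp (δ * n) := by
  filter_upwards [hp.2.eventually (gt_mem_nhds hδ), eventually_ge_atTop 1] with n hn hn1
  have hn0 : (0 : ℝ) < n := by exact_mod_cast hn1
  rw [← Real.log_le_iff_le_exp (hp.1 n)]
  rw [one_div, inv_mul_lt_iff₀ hn0] at hn
  linarith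

lemma typeLoss_eq (A : Type*) [Fintype A] (n : ℕ) :
    typeLoss A n = Real.exp 1 ^ Fintype.card A * ((n : ℝ) + 1) ^ Fintype.card A := by
  rw [typeLoss, mul_pow]

/-- Combines the comparison of the expected divergence `D` with the truncated mean `S` and that of
`S` with the exponential `γ`. -/
lemma le_mul_and_le_mul {D S b κ : ℝ} {γ : EReal} (hγ : 0 ≤ γ) (hb : 0 ≤ b) (hκ : 0 ≤ κ)
    (n : ℕ) (hDS : D ≤ (1 + b * n) * S) (hSD : S ≤ 96 * D)
    (h1 : γ ≤ ((κ * S : ℝ) : EReal)) (h2 : (S : EReal) ≤ ((2 * κ : ℝ) : EReal) * γ) :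
    (D : EReal) ≤ ((96 * (1 + b) * (n + 1) * κ : ℝ) : EReal) * γ ∧
      γ ≤ ((96 * (1 + b) * (n + 1) * κ : ℝ) : EReal) * (D : EReal) := by
  lift γ to ℝ using ⟨ne_top_of_le_ne_top (EReal.coe_ne_top _) h1,
    ne_bot_of_le_ne_bot EReal.zero_ne_bot hγ⟩
  rw [← EReal.coe_mul, EReal.coe_le_coe_iff] at h2
  rw [EReal.coe_le_coe_iff] at h1
  rw [← EReal.coe_mul, ← EReal.coe_mul, EReal.coe_le_coe_iff, EReal.coe_le_coe_iff]
  have hγ' : 0 ≤ γ := by exact_mod_cast hγ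
  have hn : (0 : ℝ) ≤ n := by positivity
  have hbn : 1 + b * n ≤ (1 + b) * (n + 1) := by nlinarith
  have hκγ : 0 ≤ κ * γ := mul_nonneg hκ hγ'
  constructor
  · calc D ≤ (1 + b * n) * S := hDS
      _ ≤ (1 + b * n) * (2 * κ * γ) := mul_le_mul_of_nonneg_left h2 (by positivity)
      _ ≤ (1 + b) * (n + 1) * (2 * κ * γ) := mul_le_mul_of_nonneg_right hbn (by linarith)
      _ ≤ 96 * (1 + b) * (n + 1) * κ * γ := by
          have : 0 ≤ (1 + b) * (n + 1) * (κ * γ) := by positivity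
          linarith
  · have h3 : γ ≤ κ * (96 * D) := h1.trans (mul_le_mul_of_nonneg_left hSD hκ)
    have h4 : 0 ≤ κ * (96 * D) := hγ'.trans h3
    have h5 : 1 ≤ (1 + b) * ((n : ℝ) + 1) := by nlinarith
    calc γ ≤ κ * (96 * D) := h3
      _ ≤ (1 + b) * ((n : ℝ) + 1) * (κ * (96 * D)) := le_mul_of_one_le_left h4 h5
      _ = _ := by ring

end Subexp

/-! ### The two ensembles -/

section Ensembles

variable {X Z : Type*} [Fintype X] [Fintype Z] {W : X → Z → ℝ} {P : X → ℝ}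

/-- The positive values of a product distribution decay at most exponentially. -/
lemma exp_le_power (hP : P ∈ stdSimplex ℝ X) {n : ℕ} (x : Fin n → X) (hx : power n P x ≠ 0) :
    Real.exp (-((∑ a, |Real.log (P a)|) * n)) ≤ power n P x := by
  have h : ∀ i, Real.exp (-∑ a, |Real.log (P a)|) ≤ P (x i) := by
    intro i
    have hi : P (x i) ≠ 0 := Finset.prod_ne_zero_iff.1 hx i (Finset.mem_univ i)
    rw [← Real.le_log_iff_exp_le (lt_of_le_of_ne (hP.1 _) hi.symm)]
    have h1 := Finset.single_le_sum (f := fun a => |Real.log (P a)|) (fun a _ => abs_nonneg _)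
      (Finset.mem_univ (x i))
    have h2 := neg_abs_le (Real.log (P (x i)))
    linarith
  calc Real.exp (-((∑ a, |Real.log (P a)|) * n))
      = ∏ _i : Fin n, Real.exp (-∑ a, |Real.log (P a)|) := by
        rw [Finset.prod_const, Finset.card_univ, Fintype.card_fin, ← Real.exp_nat_mul]
        congr 1
        ring
    _ ≤ power n P x := Finset.prod_le_prod (fun _ _ => Real.exp_nonneg _) fun i _ => h i

lemma exp_le_uniformOnType {n : ℕ} (hn : 1 ≤ n) (hP : P ∈ types n X) (x : Fin n → X)
    (hx : uniformOnType n P x ≠ 0) :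
    Real.exp (-((Fintype.card X : ℝ) * n)) ≤ uniformOnType n P x := by
  classical
  have hxP : empirical x = P := by
    by_contra h
    exact hx (uniformOnType_of_empirical_ne h)
  rw [uniformOnType_of_empirical hxP, Real.exp_neg, ← one_div]
  refine one_div_le_one_div_of_le (ncard_typeClass_pos hn hP) ?_
  have h1 : (typeClass n P).ncard ≤ Fintype.card X ^ n := by
    rw [ncard_typeClass]
    refine (Finset.card_le_univ _).trans (le_of_eq ?_)
    simp
  calc ((typeClass n P).ncard : ℝ) ≤ (Fintype.card X : ℝ) ^ n := by exact_mod_cast h1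
    _ ≤ Real.exp (Fintype.card X) ^ n := by
        refine pow_le_pow_left₀ (by positivity) ?_ n
        have := Real.add_one_le_exp (Fintype.card X : ℝ)
        linarith
    _ = Real.exp ((Fintype.card X : ℝ) * n) := by
        rw [← Real.exp_nat_mul, mul_comm]

/-- The uniform distribution on a type class is dominated, up to a polynomial factor, by the product
distribution of that type. -/
lemma output_uniformOnType_le (hW : IsChannel W) {n : ℕ} (hn : 1 ≤ n) (hP : P ∈ types n X)
    (z : Fin n → Z) :
    output (uniformOnType n P) (powerChannel n W) z ≤
      typeLoss X n * ∏ i, output P W (z i) := by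
  rw [← output_power]
  simp only [output]
  rw [Finset.mul_sum]
  refine Finset.sum_le_sum fun x _ => ?_
  rw [← mul_assoc]
  refine mul_le_mul_of_nonneg_right ?_ (powerChannel_nonneg hW n x z)
  by_cases hx : empirical x = P
  · subst hx
    rw [uniformOnType_of_empirical rfl, show power n (empirical x) x = _ from prod_empirical hn x,
      Real.exp_neg, ← div_eq_mul_inv,
      div_le_div_iff₀ (ncard_typeClass_pos hn hP) (Real.exp_pos _), one_mul]
    exact exp_entropy_le hn hP
  · rw [uniformOnType_of_empirical_ne hx]
    exact mul_nonneg (typeLoss_pos n).le ((power_mem_stdSimplex hP.1 n).1 x)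

/-- A code over inputs that all produce the same output distribution approximates it exactly. -/
lemma meanDiv_eq_zero {Ω Y : Type*} [Fintype Ω] [Fintype Y] {P : Ω → ℝ} {U : Ω → Y → ℝ}
    {q : Y → ℝ} (hP : ∑ x, P x = 1) (h : ∀ x, P x ≠ 0 → U x = q) {M : ℕ} (hM : 1 ≤ M) :
    meanDiv P U M = 0 := by
  have hM0 : (M : ℝ) ≠ 0 := by positivity
  have hq : output P U = q := by
    ext y
    calc ∑ x, P x * U x y = ∑ x, P x * q y := by
          refine Finset.sum_congr rfl fun x _ => ?_
          rcases eq_or_ne (P x) 0 with hx | hx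
          · rw [hx, zero_mul, zero_mul]
          · rw [h x hx]
      _ = q y := by rw [← Finset.sum_mul, hP, one_mul]
  refine Finset.sum_eq_zero fun c _ => ?_
  rcases eq_or_ne (∏ k, P (c k)) 0 with hc | hc
  · rw [hc, zero_mul]
  · rw [Finset.sum_eq_zero, mul_zero]
    intro y _
    have hav : 1 / (M : ℝ) * ∑ i, U (c i) y = q y := by
      rw [Finset.sum_congr rfl fun i _ =>
        congrFun (h (c i) (Finset.prod_ne_zero_iff.1 hc i (Finset.mem_univ i))) y]
      simp only [Finset.sum_const, Finset.card_univ, Fintype.card_fin, nsmul_eq_mul]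
      field_simp
    rw [hav, hq]
    rcases eq_or_ne (q y) 0 with h0 | h0
    · rw [h0, zero_mul]
    · rw [div_self h0, Real.log_one, mul_zero]

lemma expectedDiv_eq_zero (hW : IsChannel W) {PX : X → ℝ} (hPX : PX ∈ stdSimplex ℝ X)
    (hI : mutualInfo PX W = 0) {R : ℝ} (hR : 0 ≤ R) {n : ℕ} {Pn : (Fin n → X) → ℝ}
    (hPn : Pn ∈ stdSimplex ℝ (Fin n → X)) (hsupp : ∀ x, Pn x ≠ 0 → ∀ i, PX (x i) ≠ 0) :
    expectedDiv n Pn W R = 0 := by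
  rw [expectedDiv_eq hW hPn.1, EReal.coe_eq_zero]
  refine meanDiv_eq_zero (q := fun z => ∏ i, output PX W (z i)) hPn.2 (fun x hx => ?_)
    (one_le_codeSize hR n)
  ext z
  exact Finset.prod_congr rfl fun i _ => by
    rw [apply_eq_output_of_mutualInfo_eq_zero hPX hW hI (hsupp x hx i)]

open Classical in
/-- For i.i.d. codewords and positive mutual information, the likelihood ratio is at least `2` with
probability at least one half. -/
lemma eventually_half_le_power (hP : P ∈ stdSimplex ℝ X) (hW : IsChannel W)
    (hI : 0 < mutualInfo P W) :
    ∀ᶠ n : ℕ in atTop, 1 / 2 ≤ ∑ x, ∑ z,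
      if 2 * output (power n P) (powerChannel n W) z ≤ powerChannel n W x z then
        power n P x * powerChannel n W x z else 0 := by
  obtain ⟨x₀, hx₀, hne⟩ := exists_ne_output_of_mutualInfo_pos hP hW hI
  have ho := output_mem_stdSimplex hP hW
  set ρ := ∑ x, P x * affinity (W x) (output P W) with hρ
  have hρ0 : 0 ≤ ρ := Finset.sum_nonneg fun x _ => mul_nonneg (hP.1 x) (affinity_nonneg _ _)
  have hρ1 : ρ < 1 := by
    rw [← hP.2]
    refine Finset.sum_lt_sum (fun x _ => mul_le_of_le_one_right (hP.1 x)
      (affinity_le_one (hW x) ho)) ⟨x₀, Finset.mem_univ _, ?_⟩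
    exact mul_lt_of_lt_one_right (lt_of_le_of_ne (hP.1 x₀) hx₀.symm)
      (affinity_lt_one (hW x₀) ho hne)
  have hlim : Tendsto (fun n : ℕ => √(2 * 1) * ρ ^ n) atTop (𝓝 0) := by
    have := (tendsto_pow_atTop_nhds_zero_of_lt_one hρ0 hρ1).const_mul √(2 * 1)
    rwa [mul_zero] at this
  filter_upwards [hlim.eventually (gt_mem_nhds (by norm_num : (0 : ℝ) < 1 / 2))] with n hn
  have hpow := power_mem_stdSimplex hP n
  refine half_le_sum_ite hpow.1 hpow.2 (powerChannel_nonneg hW n) (sum_powerChannel hW n)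
    (q := fun z => ∏ i, output P W (z i)) zero_le_one
    (fun z => by rw [output_power, one_mul]) ?_
  refine le_of_eq_of_le ?_ hn.le
  congr 1
  simp_rw [affinity_powerChannel hW ho.1, power, ← Finset.prod_mul_distrib]
  rw [sum_pi_prod fun _ x => P x * affinity (W x) (output P W)]
  simp [hρ]

open Classical in
/-- For constant-composition codewords whose types tend to `PX` with positive mutual information,
the likelihood ratio is at least `2` with probability at least one half. -/
lemma eventually_half_le_uniformOnType {PX : X → ℝ} (hPX : PX ∈ stdSimplex ℝ X) (hW : IsChannel W)
    (hI : 0 < mutualInfo PX W) {P : ℕ → X → ℝ} (hP : ∀ n, 1 ≤ n → P n ∈ types n X)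
    (hlim : Tendsto (fun n => ∑ x, |P n x - PX x|) atTop (𝓝 0)) :
    ∀ᶠ n : ℕ in atTop, 1 / 2 ≤ ∑ x, ∑ z,
      if 2 * output (uniformOnType n (P n)) (powerChannel n W) z ≤ powerChannel n W x z then
        uniformOnType n (P n) x * powerChannel n W x z else 0 := by
  obtain ⟨x₀, hx₀, hne⟩ := exists_ne_output_of_mutualInfo_pos hPX hW hI
  have ho := output_mem_stdSimplex hPX hW
  have hx₀pos : 0 < PX x₀ := lt_of_le_of_ne (hPX.1 x₀) hx₀.symm
  have hcoord : ∀ x, Tendsto (fun n => P n x) atTop (𝓝 (PX x)) := by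
    intro x
    rw [tendsto_iff_dist_tendsto_zero]
    refine squeeze_zero (fun _ => dist_nonneg) (fun n => ?_) hlim
    rw [Real.dist_eq]
    exact Finset.single_le_sum (f := fun x => |P n x - PX x|) (fun _ _ => abs_nonneg _)
      (Finset.mem_univ x)
  have hout : ∀ z, Tendsto (fun n => output (P n) W z) atTop (𝓝 (output PX W z)) := fun z =>
    tendsto_finsetSum _ fun x _ => (hcoord x).mul_const _
  have haff : Tendsto (fun n => affinity (W x₀) (output (P n) W)) atTop
      (𝓝 (affinity (W x₀) (output PX W))) :=
    tendsto_finsetSum _ fun z _ => ((hout z).const_mul _).sqrt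
  obtain ⟨ρ, hρ, hρ1⟩ := exists_between (affinity_lt_one (hW x₀) ho hne)
  have hρ0 : 0 < ρ := (affinity_nonneg _ _).trans_lt hρ
  have hlog : Real.log ρ < 0 := Real.log_neg hρ0 hρ1
  -- the affinity decays like `exp (-2 δ n)`, which beats the square root of the polynomial factor
  set δ := -(PX x₀ / 2 * Real.log ρ) / 2 with hδ
  have hδ0 : 0 < δ := by
    have := mul_neg_of_pos_of_neg (half_pos hx₀pos) hlog
    rw [hδ]
    linarith
  have hpoly := (subexponential_poly (C := 2 * 4 * Real.exp 1 ^ Fintype.card X) (by positivity)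
    (Fintype.card X)).eventually_le_exp (mul_pos four_pos hδ0)
  filter_upwards [eventually_ge_atTop 1, hpoly, haff.eventually (gt_mem_nhds hρ),
    (hcoord x₀).eventually (lt_mem_nhds (half_lt_self hx₀pos))] with n hn hpoly hρn hxn
  have hPn := hP n hn
  have hon := output_mem_stdSimplex hPn.1 hW
  refine half_le_sum_ite (uniformOnType_nonneg n _) (sum_uniformOnType hn hPn)
    (powerChannel_nonneg hW n) (sum_powerChannel hW n) (q := fun z => ∏ i, output (P n) W (z i))
    (typeLoss_pos n).le (output_uniformOnType_le hW hn hPn) ?_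
  have haffle : ∀ x : Fin n → X, uniformOnType n (P n) x *
      affinity (powerChannel n W x) (fun z => ∏ i, output (P n) W (z i)) ≤
        uniformOnType n (P n) x * Real.exp (-(2 * δ * n)) := by
    intro x
    by_cases hx : empirical x = P n
    · refine mul_le_mul_of_nonneg_left ?_ (uniformOnType_nonneg n _ x)
      rw [affinity_powerChannel hW hon.1,
        prod_apply_eq_prod_pow x fun a => affinity (W a) (output (P n) W)]
      have hk : (Nat.card {i // x i = x₀} : ℝ) = n * P n x₀ := by
        rw [← hx]
        simp only [empirical]
        field_simp
      calc ∏ a, affinity (W a) (output (P n) W) ^ Nat.card {i // x i = a}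
          ≤ ∏ a, if a = x₀ then ρ ^ Nat.card {i // x i = x₀} else 1 := by
            refine Finset.prod_le_prod (fun a _ => pow_nonneg (affinity_nonneg _ _) _) fun a _ => ?_
            split_ifs with ha
            · subst ha
              exact pow_le_pow_left₀ (affinity_nonneg _ _) hρn.le _
            · exact pow_le_one₀ (affinity_nonneg _ _) (affinity_le_one (hW a) hon)
        _ = Real.exp (n * P n x₀ * Real.log ρ) := by
            rw [Finset.prod_ite_eq', if_pos (Finset.mem_univ _), ← hk, Real.exp_nat_mul,
              Real.exp_log hρ0]
        _ ≤ Real.exp (-(2 * δ * n)) := by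
            refine Real.exp_le_exp.2 ?_
            have h1 : P n x₀ * Real.log ρ ≤ PX x₀ / 2 * Real.log ρ :=
              mul_le_mul_of_nonpos_right hxn.le hlog.le
            have h2 := mul_le_mul_of_nonneg_left h1 (n.cast_nonneg (α := ℝ))
            rw [hδ]
            linarith
    · rw [uniformOnType_of_empirical_ne hx, zero_mul, zero_mul]
  have hsqrt : √(2 * typeLoss X n) ≤ 1 / 2 * Real.exp (2 * δ * n) := by
    refine Real.sqrt_le_iff.2 ⟨by positivity, ?_⟩
    rw [mul_pow, ← Real.exp_nat_mul, typeLoss_eq]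
    have : Real.exp (4 * δ * n) = Real.exp ((2 : ℕ) * (2 * δ * n)) := by
      congr 1
      push_cast
      ring
    rw [← this]
    linarith
  calc √(2 * typeLoss X n) * ∑ x, uniformOnType n (P n) x *
        affinity (powerChannel n W x) (fun z => ∏ i, output (P n) W (z i))
      ≤ (1 / 2 * Real.exp (2 * δ * n)) * ∑ x, uniformOnType n (P n) x * Real.exp (-(2 * δ * n)) :=
        mul_le_mul hsqrt (Finset.sum_le_sum fun x _ => haffle x)
          (Finset.sum_nonneg fun x _ => mul_nonneg (uniformOnType_nonneg n _ x)
            (affinity_nonneg _ _)) (by positivity)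
    _ = 1 / 2 := by
        rw [← Finset.sum_mul, sum_uniformOnType hn hPn, one_mul, mul_assoc, ← Real.exp_add]
        simp

/-- The exponent of the i.i.d. ensemble. -/
lemma exists_dotEqBy_power (hW : IsChannel W) (hP : P ∈ stdSimplex ℝ X) {R : ℝ} (hR : 0 ≤ R)
    (hI : 0 < mutualInfo P W) :
    ∃ p, Subexponential p ∧ DotEqBy p (fun n => expectedDiv n (power n P) W R)
      (fun n => expNeg n (expIID n P W R)) := by
  set b := ∑ a, |Real.log (P a)|
  have hb0 : 0 ≤ b := Finset.sum_nonneg fun _ _ => abs_nonneg _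
  set d := Fintype.card (X × Z)
  refine ⟨_, subexponential_poly (C := 96 * (1 + b) * Real.exp 1 ^ d) (by positivity) (d + 1), ?_⟩
  filter_upwards [eventually_ge_atTop 1, eventually_half_le_power hP hW hI] with n hn hhalf
  have hpow := power_mem_stdSimplex hP n
  have hM := one_le_codeSize hR n
  have h1 := meanDiv_le hpow.1 hpow.2 (powerChannel_nonneg hW n) hM
    (b := b * n) (by positivity) (exp_le_power hP)
  have h2 := truncatedMean_le hpow.1 hpow.2 (powerChannel_nonneg hW n) (sum_powerChannel hW n) hM
    hhalf
  obtain ⟨h3, h4⟩ := expIID_bounds hP hW hR hn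
  have h5 := le_mul_and_le_mul (expNeg_nonneg n _) hb0 (typeLoss_pos n).le n h1 h2 h3 h4
  rw [expectedDiv_eq hW hpow.1]
  have hp : 96 * (1 + b) * ((n : ℝ) + 1) * typeLoss (X × Z) n =
      96 * (1 + b) * Real.exp 1 ^ d * ((n : ℝ) + 1) ^ (d + 1) := by
    rw [typeLoss_eq]
    ring
  rwa [hp] at h5

/-- The exponent of the constant-composition ensemble. -/
lemma exists_dotEqBy_uniformOnType (hW : IsChannel W) {PX : X → ℝ} (hPX : PX ∈ stdSimplex ℝ X)
    {R : ℝ} (hR : 0 ≤ R) (hI : 0 < mutualInfo PX W) :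
    ∃ p, Subexponential p ∧ ∀ P : ℕ → X → ℝ, (∀ n, 1 ≤ n → P n ∈ types n X) →
      Tendsto (fun n => ∑ x, |P n x - PX x|) atTop (𝓝 0) →
      DotEqBy p (fun n => expectedDiv n (uniformOnType n (P n)) W R)
        (fun n => expNeg n (expCC n (P n) W R)) := by
  set b : ℝ := (Fintype.card X : ℝ)
  have hb0 : 0 ≤ b := Nat.cast_nonneg _
  set d := Fintype.card X + Fintype.card (X × Z) * 2 + Fintype.card Z with hd
  refine ⟨_, subexponential_poly (C := 96 * (1 + b) * Real.exp 1 ^ d) (by positivity) (d + 1),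
    fun P hP hlim => ?_⟩
  filter_upwards [eventually_ge_atTop 1, eventually_half_le_uniformOnType hPX hW hI hP hlim]
    with n hn hhalf
  have hPn := hP n hn
  have hM := one_le_codeSize hR n
  have hu0 := uniformOnType_nonneg n (P n)
  have h1 := meanDiv_le hu0 (sum_uniformOnType hn hPn) (powerChannel_nonneg hW n) hM
    (b := b * n) (by positivity) (exp_le_uniformOnType hn hPn)
  have h2 := truncatedMean_le hu0 (sum_uniformOnType hn hPn) (powerChannel_nonneg hW n)
    (sum_powerChannel hW n) hM hhalf
  obtain ⟨h3, h4⟩ := expCC_bounds hW hR hn hPn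
  have hκX := typeLoss_pos (A := X) n
  have hκ := typeLoss_pos (A := X × Z) n
  have hκZ := one_le_typeLoss (A := Z) n
  set κ := typeLoss X n * typeLoss (X × Z) n ^ 2 * typeLoss Z n with hκdef
  have h4' : ((truncatedMean (uniformOnType n (P n)) (powerChannel n W) (codeSize n R) : ℝ) :
      EReal) ≤ ((2 * κ : ℝ) : EReal) * expNeg n (expCC n (P n) W R) := by
    refine h4.trans (mul_le_mul_of_nonneg_right ?_ (expNeg_nonneg n _))
    rw [EReal.coe_le_coe_iff]
    have := le_mul_of_one_le_right (by positivity :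
      0 ≤ 2 * (typeLoss X n * typeLoss (X × Z) n ^ 2)) hκZ
    rw [hκdef]
    linarith
  have h5 := le_mul_and_le_mul (expNeg_nonneg n _) hb0 (by positivity) n h1 h2 h3 h4'
  rw [expectedDiv_eq hW hu0]
  have hp : 96 * (1 + b) * ((n : ℝ) + 1) * κ =
      96 * (1 + b) * Real.exp 1 ^ d * ((n : ℝ) + 1) ^ (d + 1) := by
    rw [hκdef, typeLoss_eq, typeLoss_eq, typeLoss_eq, hd]
    ring
  rwa [hp] at h5

end Ensembles

end Resolvability

end

theorem mainTheorem2 {X Z : Type*} [Fintype X] [Fintype Z]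
    (W : X → Z → ℝ) (hW : Resolvability.IsChannel W)
    (PX : X → ℝ) (hPX : PX ∈ stdSimplex ℝ X) (R : ℝ) (hR : 0 ≤ R) :
    -- i.i.d. sampling
    ((0 < Resolvability.mutualInfo PX W →
        ∃ p, Resolvability.Subexponential p ∧
          Resolvability.DotEqBy p
            (fun n => Resolvability.expectedDiv n (Resolvability.power n PX) W R)
            (fun n => Resolvability.expNeg n (Resolvability.expIID n PX W R))) ∧
      (Resolvability.mutualInfo PX W = 0 →
        ∀ n : ℕ, Resolvability.expectedDiv n (Resolvability.power n PX) W R = 0)) ∧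
    -- uniform sampling on type classes
    ((0 < Resolvability.mutualInfo PX W →
        ∃ p, Resolvability.Subexponential p ∧
          ∀ P : ℕ → X → ℝ, (∀ n, 1 ≤ n → P n ∈ Resolvability.types n X) →
            Tendsto (fun n => ∑ x, |P n x - PX x|) atTop (𝓝 0) →
            Resolvability.DotEqBy p
              (fun n => Resolvability.expectedDiv n (Resolvability.uniformOnType n (P n)) W R)
              (fun n => Resolvability.expNeg n (Resolvability.expCC n (P n) W R))) ∧
      (Resolvability.mutualInfo PX W = 0 →
        ∀ n : ℕ, 1 ≤ n → ∀ P ∈ Resolvability.types n X, (∀ x, PX x = 0 → P x = 0) →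
          Resolvability.expectedDiv n (Resolvability.uniformOnType n P) W R = 0)) := by
  refine ⟨⟨Resolvability.exists_dotEqBy_power hW hPX hR, fun hI n => ?_⟩,
    Resolvability.exists_dotEqBy_uniformOnType hW hPX hR, fun hI n hn P hP hsupp => ?_⟩
  · exact Resolvability.expectedDiv_eq_zero hW hPX hI hR
      (Resolvability.power_mem_stdSimplex hPX n)
      fun x hx i => Finset.prod_ne_zero_iff.1 hx i (Finset.mem_univ i)
  · refine Resolvability.expectedDiv_eq_zero hW hPX hI hR
      ⟨Resolvability.uniformOnType_nonneg n P, Resolvability.sum_uniformOnType hn hP⟩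
      fun x hx i h0 => ?_
    have hxP : Resolvability.empirical x = P := by
      by_contra h
      exact hx (Resolvability.uniformOnType_of_empirical_ne h)
    exact Resolvability.empirical_apply_ne_zero hn x i (by rw [hxP, hsupp _ h0])
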